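/- Let $\mathbb{F}$ be any field and let $\mathbb{P}^2$ be the projective plane over $\mathbb{F}$. Let $X\subseteq\mathbb{P}^2$ be a smooth plane curve of degree $c$, let $d$ be an integer with $0<d<c$, let $E\subseteq X$ be a zero-dimensional (possibly empty) closed subscheme, and let $B\subseteq X(\mathbb{F})$ be a finite set of rational points with $B\cap E_{red}=\emptyset$. Let $C\subseteq\mathbb{F}^B$ be the code obtained by evaluating $H^0(X,\mathcal{O}_X(d)(-E))$ at the points of $B$, with respect to arbitrarily fixed homogeneous coordinates of these points, and let $C^\perp\subseteq\mathbb{F}^B$ be its dual code, i.e. the set of all $v$ with $\sum_{P\in B}v_Pc_P=0$ for all $c\in C$. For a finite set $S\subseteq B$ let $\mathcal{I}_{E\cup S}$ be the ideal sheaf in $\mathcal{O}_{\mathbb{P}^2}$ of the union of $E$ and the reduced scheme $S$, and write $h^1=\dim_{\mathbb{F}}H^1$. Let $z\in\mathbb{N}\cup\{\infty\}$ be the minimal cardinality of a subset $S\subseteq B$ such that $h^1(\mathbb{P}^2,\mathcal{I}_{E\cup S}(d))>h^1(\mathbb{P}^2,\mathcal{I}_E(d))$ ($z=\infty$ if there is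 no such $S$). Then: 1. The minimum distance of $C^\perp$ is $z$ (the minimum distance of the zero code being $\infty$). 2. A codeword of $C^\perp$ has weight $z$ if and only if its support is a subset $S\subseteq B$ such that (a) $\sharp S=z$; (b) $h^1(\mathbb{P}^2,\mathcal{I}_{E\cup S}(d))>h^1(\mathbb{P}^2,\mathcal{I}_E(d))$; (c) $h^1(\mathbb{P}^2,\mathcal{I}_{E\cup S}(d))>h^1(\mathbb{P}^2,\mathcal{I}_{E\cup S'}(d))$ for every $S'\subsetneq S$. Moreover, a subset $S\subseteq B$ is the support of a codeword of $C^\perp$ of weight $z$ if and only if it satisfies (a), (b) and (c). -/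

import Mathlib

namespace PlaneCode

noncomputable section

open MvPolynomial

/-- The homogeneous coordinate ring `F[x₀, x₁, x₂]` of the projective plane over `F`. -/
abbrev CoordRing (F : Type*) [Field F] : Type _ := MvPolynomial (Fin 3) F

/-- The field `F(x₀, x₁, x₂)`. All sections of twists of ideal sheaves over the charts below are
elements of this field, and restriction maps are inclusions. -/
abbrev FracField (F : Type*) [Field F] : Type _ := FractionRing (CoordRing F)

/-- The rational points of the projective plane over `F`. -/
abbrev Point (F : Type*) [Field F] : Type _ := Projectivization F (Fin 3 → F)

attribute [local instance] MvPolynomial.gradedAlgebra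

variable {F : Type*} [Field F]

/-! ### Closed subschemes of the plane -/

/-- A closed subscheme of the projective plane over `F`, given by its saturated homogeneous
ideal. The empty scheme corresponds to the unit ideal. -/
structure Subscheme (F : Type*) [Field F] where
  ideal : Ideal (CoordRing F)
  homogeneous : ideal.IsHomogeneous (homogeneousSubmodule (Fin 3) F)
  saturated : ∀ g : CoordRing F, (∀ i, ∃ n : ℕ, X i ^ n * g ∈ ideal) → g ∈ ideal

/-- The underlying set of a closed subscheme: the relevant homogeneous primes containing its
ideal. -/
def Subscheme.support (Z : Subscheme F) :
    Set (ProjectiveSpectrum (homogeneousSubmodule (Fin 3) F)) :=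
  ProjectiveSpectrum.zeroLocus _ (Z.ideal : Set (CoordRing F))

/-- `Z` is a zero-dimensional scheme (the empty scheme is allowed). -/
def Subscheme.IsZeroDimensional (Z : Subscheme F) : Prop :=
  topologicalKrullDim Z.support ≤ 0

/-- The scheme-theoretic union: the intersection of the ideals. -/
def Subscheme.union (Z W : Subscheme F) : Subscheme F where
  ideal := Z.ideal ⊓ W.ideal
  homogeneous := Z.homogeneous.inf W.homogeneous
  saturated g hg :=
    ⟨Z.saturated g fun i => (hg i).imp fun _ h => h.1,
      W.saturated g fun i => (hg i).imp fun _ h => h.2⟩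

/-- The homogeneous ideal of the point with homogeneous coordinates `p`: the polynomials that
vanish identically on the line `t ↦ t • p`, that is, all of whose homogeneous components vanish
at `p`. -/
def pointIdeal (p : Fin 3 → F) : Ideal (CoordRing F) :=
  RingHom.ker (aeval (fun i => Polynomial.C (p i) * Polynomial.X) :
    CoordRing F →ₐ[F] Polynomial F)

theorem aeval_line_of_isHomogeneous (p : Fin 3 → F) {g : CoordRing F} {n : ℕ}
    (hg : g.IsHomogeneous n) :
    aeval (fun i => Polynomial.C (p i) * Polynomial.X) g
      = Polynomial.C (eval p g) * Polynomial.X ^ n := by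
  rw [aeval_def, eval₂_eq', eval_eq', map_sum, Finset.sum_mul]
  refine Finset.sum_congr rfl fun m hm => ?_
  have h : ∑ i, m i = n := by
    have := hg (mem_support_iff.mp hm)
    rw [Finsupp.weight_apply, Finsupp.sum_fintype _ _ (by simp)] at this
    simpa using this
  rw [← h, ← Finset.prod_pow_eq_pow_sum]
  simp only [mul_pow, Finset.prod_mul_distrib, map_mul, map_prod, map_pow]
  simp [Polynomial.algebraMap_eq, mul_assoc]

theorem mem_pointIdeal_iff (p : Fin 3 → F) (g : CoordRing F) :
    g ∈ pointIdeal p ↔ ∀ n, eval p (homogeneousComponent n g) = 0 := by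
  have key : ∀ n, (aeval (fun i => Polynomial.C (p i) * Polynomial.X) g).coeff n
      = eval p (homogeneousComponent n g) := by
    intro n
    conv_lhs => rw [← sum_homogeneousComponent g]
    rw [map_sum, Polynomial.finsetSum_coeff]
    simp only [aeval_line_of_isHomogeneous p (homogeneousComponent_isHomogeneous _ g),
      Polynomial.coeff_C_mul_X_pow]
    rw [Finset.sum_ite_eq]
    split_ifs with h
    · rfl
    · rw [homogeneousComponent_eq_zero _ _ (by simpa using h), map_zero]
  rw [pointIdeal, RingHom.mem_ker]
  simp only [← key]
  exact ⟨fun h n => by simpa using congrArg (fun q => Polynomial.coeff q n) h,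
    fun h => Polynomial.ext (by simpa using h)⟩

theorem pointIdeal_isHomogeneous (p : Fin 3 → F) :
    (pointIdeal p).IsHomogeneous (homogeneousSubmodule (Fin 3) F) := by
  intro n g hg
  rw [mem_pointIdeal_iff] at hg
  have h : (DirectSum.decompose (homogeneousSubmodule (Fin 3) F) g n : CoordRing F)
      = homogeneousComponent n g := MvPolynomial.decomposition.decompose'_apply g n
  rw [h, mem_pointIdeal_iff]
  intro m
  rw [homogeneousComponent_of_mem (homogeneousComponent_isHomogeneous n g)]
  split_ifs
  · exact hg n
  · exact map_zero _

/-- A finite set of rational points, with its reduced scheme structure. -/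
def Subscheme.ofPoints (S : Finset (Point F)) : Subscheme F where
  ideal := ⨅ P ∈ S, pointIdeal P.rep
  homogeneous := Ideal.IsHomogeneous.iInf₂ fun P _ => pointIdeal_isHomogeneous (Projectivization.rep P)
  saturated g hg := by
    simp only [Submodule.mem_iInf] at hg ⊢
    intro P hP
    obtain ⟨i, hi⟩ := Function.ne_iff.mp P.rep_nonzero
    obtain ⟨n, hn⟩ := hg i
    have h := hn P hP
    rw [pointIdeal, RingHom.mem_ker, map_mul, map_pow, mul_eq_zero] at h
    refine h.resolve_left (pow_ne_zero _ ?_)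
    simpa using hi

/-! ### Sections over the standard charts and Čech cohomology -/

/-- For a homogeneous ideal `I`, the sections of the sheaf `Ĩ(d)` over the open set
where the coordinates `xᵢ`, `i ∈ T`, do not vanish: the fractions `a / (∏ i ∈ T, xᵢ) ^ n` of
degree `d` with `a ∈ I`. -/
def chartSections (I : Ideal (CoordRing F)) (d : ℕ) (T : Finset (Fin 3)) :
    Submodule F (FracField F) where
  carrier := {y | ∃ (n : ℕ) (a : CoordRing F), a ∈ I ∧ a.IsHomogeneous (d + n * T.card) ∧
    y = algebraMap (CoordRing F) (FracField F) a /
      algebraMap (CoordRing F) (FracField F) (∏ i ∈ T, X i) ^ n}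
  zero_mem' := ⟨0, 0, I.zero_mem, isHomogeneous_zero _ _ _, by simp⟩
  add_mem' := by
    rintro _ _ ⟨n, a, ha, hda, rfl⟩ ⟨m, b, hb, hdb, rfl⟩
    have hT : (∏ i ∈ T, X i : CoordRing F).IsHomogeneous T.card := by
      simpa using IsHomogeneous.prod T (fun i => (X i : CoordRing F)) (fun _ => 1)
        fun i _ => isHomogeneous_X F i
    have h0 : algebraMap (CoordRing F) (FracField F) (∏ i ∈ T, X i) ≠ 0 := by
      simp [Finset.prod_eq_zero_iff]
    refine ⟨n + m, a * (∏ i ∈ T, X i) ^ m + b * (∏ i ∈ T, X i) ^ n,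
      I.add_mem (I.mul_mem_right _ ha) (I.mul_mem_right _ hb), ?_, ?_⟩
    · refine IsHomogeneous.add ?_ ?_
      · convert hda.mul (hT.pow m) using 1; ring
      · convert hdb.mul (hT.pow n) using 1; ring
    · simp only [map_add, map_mul, map_pow]
      field_simp
      ring
  smul_mem' := by
    rintro r _ ⟨n, a, ha, hda, rfl⟩
    refine ⟨n, C r * a, I.mul_mem_left _ ha, ?_, ?_⟩
    · simpa using (isHomogeneous_C (Fin 3) r).mul hda
    · rw [Algebra.smul_def, map_mul, mul_div_assoc]
      rfl

/-- Restriction to a smaller chart. -/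
theorem chartSections_mono (I : Ideal (CoordRing F)) (d : ℕ) {T T' : Finset (Fin 3)}
    (h : T ⊆ T') : chartSections I d T ≤ chartSections I d T' := by
  rintro _ ⟨n, a, ha, hda, rfl⟩
  have hT : (∏ i ∈ T' \ T, X i : CoordRing F).IsHomogeneous (T' \ T).card := by
    simpa using IsHomogeneous.prod (T' \ T) (fun i => (X i : CoordRing F)) (fun _ => 1)
      fun i _ => isHomogeneous_X F i
  have h0 : ∀ U : Finset (Fin 3),
      algebraMap (CoordRing F) (FracField F) (∏ i ∈ U, X i) ≠ 0 := by
    simp [Finset.prod_eq_zero_iff]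
  refine ⟨n, a * (∏ i ∈ T' \ T, X i) ^ n, I.mul_mem_right _ ha, ?_, ?_⟩
  · convert hda.mul (hT.pow n) using 1
    rw [← Finset.card_sdiff_add_card_eq_card h]; ring
  · rw [← Finset.prod_sdiff h, map_mul, map_mul, map_pow]
    have h1 := h0 T
    have h2 := h0 (T' \ T)
    rw [mul_pow]
    field_simp

/-- Čech 1-cocycles of `Ĩ(d)` for the cover of the plane by the three charts `xᵢ ≠ 0`. -/
def cechCocycles (I : Ideal (CoordRing F)) (d : ℕ) :
    Submodule F (Fin 3 → Fin 3 → FracField F) where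
  carrier := {s | (∀ i j, s i j ∈ chartSections I d {i, j}) ∧
    ∀ i j k, s j k - s i k + s i j = 0}
  zero_mem' := ⟨fun _ _ => Submodule.zero_mem _, by simp⟩
  add_mem' := by
    rintro s t ⟨hs, hs'⟩ ⟨ht, ht'⟩
    refine ⟨fun i j => Submodule.add_mem _ (hs i j) (ht i j), fun i j k => ?_⟩
    have h1 := hs' i j k
    have h2 := ht' i j k
    simp only [Pi.add_apply]
    linear_combination h1 + h2
  smul_mem' := by
    rintro r s ⟨hs, hs'⟩
    refine ⟨fun i j => Submodule.smul_mem _ r (hs i j), fun i j k => ?_⟩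
    simp only [Pi.smul_apply, ← smul_sub, ← smul_add, hs' i j k, smul_zero]

/-- Čech 1-coboundaries of `Ĩ(d)`. -/
def cechCoboundaries (I : Ideal (CoordRing F)) (d : ℕ) :
    Submodule F (Fin 3 → Fin 3 → FracField F) where
  carrier := {s | ∃ t : Fin 3 → FracField F, (∀ i, t i ∈ chartSections I d {i}) ∧
    ∀ i j, s i j = t j - t i}
  zero_mem' := ⟨0, fun _ => Submodule.zero_mem _, by simp⟩
  add_mem' := by
    rintro s s' ⟨t, ht, hs⟩ ⟨t', ht', hs'⟩
    refine ⟨t + t', fun i => Submodule.add_mem _ (ht i) (ht' i), fun i j => ?_⟩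
    simp only [Pi.add_apply, hs, hs']
    ring
  smul_mem' := by
    rintro r s ⟨t, ht, hs⟩
    refine ⟨r • t, fun i => Submodule.smul_mem _ r (ht i), fun i j => ?_⟩
    simp only [Pi.smul_apply, hs, smul_sub]

/-- The cohomology group `H¹(ℙ², I_Z(d))` of the twisted ideal sheaf of `Z`, computed by the
Čech complex of the standard affine cover. -/
abbrev H1 (Z : Subscheme F) (d : ℕ) : Type _ :=
  cechCocycles Z.ideal d ⧸
    (cechCoboundaries Z.ideal d).comap (cechCocycles Z.ideal d).subtype

/-- `h¹(ℙ², I_Z(d))`. -/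
def h1 (Z : Subscheme F) (d : ℕ) : ℕ := Module.finrank F (H1 Z d)

/-! ### The curve, the line bundle and the code -/

/-- The homogeneous form `f` of degree `c` defines a smooth plane curve: it has no singular
point over an algebraic closure. -/
def IsSmoothCurve (f : CoordRing F) (c : ℕ) : Prop :=
  f.IsHomogeneous c ∧ ∀ p : Fin 3 → AlgebraicClosure F, p ≠ 0 → aeval p f = 0 →
    ∃ i, aeval p (pderiv i f) ≠ 0

/-- For the curve `X` with equation `f` and a closed subscheme `E` of `X`, the space
`H⁰(X, 𝒪_X(d)(-E))` of global sections of the sheaf `(I_E / I_X)(d)`: a section over each chart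
`xᵢ ≠ 0`, that is, an element of `I_E(d) / I_X(d)` there, such that these agree on overlaps. -/
def curveSections (f : CoordRing F) (E : Subscheme F) (d : ℕ) :
    Submodule F (∀ i : Fin 3, FracField F ⧸ chartSections (Ideal.span {f}) d {i}) where
  carrier := {s | (∀ i, s i ∈ (chartSections E.ideal d {i}).map
      (chartSections (Ideal.span {f}) d {i}).mkQ) ∧
    ∀ i j,
      Submodule.factor (chartSections_mono (Ideal.span {f}) d (T := {i}) (T' := {i, j})
        (by simp)) (s i) =
      Submodule.factor (chartSections_mono (Ideal.span {f}) d (T := {j}) (T' := {i, j})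
        (by simp)) (s j)}
  zero_mem' := ⟨fun _ => Submodule.zero_mem _, by simp⟩
  add_mem' := by
    rintro s t ⟨hs, hs'⟩ ⟨ht, ht'⟩
    refine ⟨fun i => Submodule.add_mem _ (hs i) (ht i), fun i j => ?_⟩
    simp only [Pi.add_apply, map_add, hs' i j, ht' i j]
  smul_mem' := by
    rintro r s ⟨hs, hs'⟩
    refine ⟨fun i => Submodule.smul_mem _ r (hs i), fun i j => ?_⟩
    simp only [Pi.smul_apply, map_smul, hs' i j]

/-- The local section `s` over the chart `xᵢ ≠ 0` has value `v` at the point of the curve with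
homogeneous coordinates `p` (where `p i ≠ 0`): `s` is represented by a fraction `a / xᵢ ^ n` of
degree `d` whose value at `p` is `v`. -/
def HasValueAt (f : CoordRing F) (d : ℕ) (i : Fin 3)
    (s : FracField F ⧸ chartSections (Ideal.span {f}) d {i}) (p : Fin 3 → F) (v : F) : Prop :=
  ∃ (n : ℕ) (a : CoordRing F), a.IsHomogeneous (d + n) ∧
    s = Submodule.Quotient.mk (algebraMap (CoordRing F) (FracField F) a /
      algebraMap (CoordRing F) (FracField F) (X i) ^ n) ∧
    v = eval p a / p i ^ n

/-- The code obtained by evaluating `H⁰(X, 𝒪_X(d)(-E))` at a family of points of the curve `X`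
with equation `f`, given by homogeneous coordinates `p k`. -/
def evaluationCode {ι : Type*} (f : CoordRing F) (E : Subscheme F) (d : ℕ)
    (p : ι → Fin 3 → F) : Submodule F (ι → F) where
  carrier := {v | ∃ s ∈ curveSections f E d,
    ∀ k i, p k i ≠ 0 → HasValueAt f d i (s i) (p k) (v k)}
  zero_mem' := ⟨0, Submodule.zero_mem _, fun k i _ =>
    ⟨0, 0, isHomogeneous_zero _ _ _, by simp, by simp⟩⟩
  add_mem' := by
    rintro v w ⟨s, hs, hv⟩ ⟨t, ht, hw⟩
    refine ⟨s + t, Submodule.add_mem _ hs ht, fun k i hi => ?_⟩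
    obtain ⟨n, a, ha, hsa, hva⟩ := hv k i hi
    obtain ⟨m, b, hb, htb, hwb⟩ := hw k i hi
    have h0 : algebraMap (CoordRing F) (FracField F) (X i) ≠ 0 := by simp
    refine ⟨n + m, a * X i ^ m + b * X i ^ n, ?_, ?_, ?_⟩
    · refine IsHomogeneous.add ?_ ?_
      · convert ha.mul ((isHomogeneous_X F i).pow m) using 1; ring
      · convert hb.mul ((isHomogeneous_X F i).pow n) using 1; ring
    · rw [Pi.add_apply, hsa, htb, ← Submodule.Quotient.mk_add]
      congr 1
      simp only [map_add, map_mul, map_pow]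
      field_simp
      ring
    · rw [Pi.add_apply, hva, hwb]
      simp only [map_add, map_mul, map_pow, eval_X]
      field_simp
      ring
  smul_mem' := by
    rintro r v ⟨s, hs, hv⟩
    refine ⟨r • s, Submodule.smul_mem _ r hs, fun k i hi => ?_⟩
    obtain ⟨n, a, ha, hsa, hva⟩ := hv k i hi
    refine ⟨n, C r * a, ?_, ?_, ?_⟩
    · simpa using (isHomogeneous_C (Fin 3) r).mul ha
    · rw [Pi.smul_apply, hsa, ← Submodule.Quotient.mk_smul, Algebra.smul_def, map_mul,
        mul_div_assoc]
      rfl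
    · rw [Pi.smul_apply, hva]
      simp [mul_div_assoc]

/-! ### Linear codes -/

/-- The dual code. -/
def dualCode {ι : Type*} [Fintype ι] (C : Submodule F (ι → F)) : Submodule F (ι → F) where
  carrier := {v | ∀ c ∈ C, v ⬝ᵥ c = 0}
  zero_mem' := fun c _ => zero_dotProduct c
  add_mem' := fun {v w} hv hw c hc => by rw [add_dotProduct, hv c hc, hw c hc, add_zero]
  smul_mem' := fun r v hv c hc => by rw [smul_dotProduct, hv c hc, smul_zero]

open Classical in
/-- The Hamming weight. -/
def weight {ι : Type*} [Fintype ι] (v : ι → F) : ℕ := hammingNorm v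

open Classical in
/-- The minimum distance of a code, which is `∞` for the zero code. -/
def minDist {ι : Type*} [Fintype ι] (C : Submodule F (ι → F)) : ℕ∞ :=
  ⨅ (v ∈ C) (w ∈ C) (_ : v ≠ w), (hammingDist v w : ℕ∞)

/-- The word `v`, indexed by the points of `B`, has support exactly `S`. -/
def HasSupport {B : Finset (Point F)} (v : B → F) (S : Finset (Point F)) : Prop :=
  S ⊆ B ∧ ∀ P : B, v P ≠ 0 ↔ (P : Point F) ∈ S

end

end PlaneCode

open PlaneCode
/-!
For `S ⊆ B` away from `E`, sections of `I_E(d)` near `P ∈ S` have a value at `P`, and the resulting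
exact sequence
`0 → H⁰(I_{E ∪ S}(d)) → H⁰(I_E(d)) → Fˢ → H¹(I_{E ∪ S}(d)) → H¹(I_E(d)) → 0`
shows that `h¹(I_{E ∪ S}(d)) - h¹(I_E(d))` is the codimension in `Fˢ` of the values of
`H⁰(I_E(d))` on `S`. As `H¹(ℙ², I_X(d)) = 0`, the code `C` consists of the values on `B` of the
degree `d` forms in `I_E`, so by duality that codimension is the dimension of the space of words
of `C^⊥` supported in `S`. Hence (b) says that some nonzero word of `C^⊥` is supported in `S`, and
(c) that no proper subset `S'` of `S` supports all the words of `C^⊥` supported in `S`.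
-/

namespace PlaneCode

noncomputable section

open MvPolynomial Filter

attribute [local instance] MvPolynomial.gradedAlgebra

theorem mem_span_singleton_of_isRelPrime {R : Type*} [CommRing R] [IsDomain R]
    [UniqueFactorizationMonoid R] {g u v h : R} (huv : IsRelPrime u v)
    (hu : u * h ∈ Ideal.span {g}) (hv : v * h ∈ Ideal.span {g}) : h ∈ Ideal.span {g} := by
  let := UniqueFactorizationMonoid.toGCDMonoid R
  rw [Ideal.mem_span_singleton] at *
  exact (dvd_gcd hu hv).trans <| (gcd_mul_right' h u v).dvd.trans
    ((gcd_isUnit_iff_isRelPrime.2 huv).mul_left_dvd.2 dvd_rfl)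

theorem exists_algebraMap_eq_of_isRelPrime {R K : Type*} [CommRing R] [IsDomain R]
    [DecompositionMonoid R] [Field K] [Algebra R K] [IsFractionRing R K] {u v a b : R} {y : K}
    (huv : IsRelPrime u v) (hu0 : u ≠ 0) (hu : y * algebraMap R K u = algebraMap R K a)
    (hv : y * algebraMap R K v = algebraMap R K b) : ∃ h, y = algebraMap R K h := by
  have hav : a * v = b * u := by
    apply IsFractionRing.injective R K
    rw [map_mul, map_mul, ← hu, ← hv]
    ring
  obtain ⟨h, rfl⟩ := huv.dvd_of_dvd_mul_right (Dvd.intro_left _ hav.symm)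
  refine ⟨h, mul_right_cancel₀ (b := algebraMap R K u) ?_ ?_⟩
  · simpa using hu0
  · rw [hu, map_mul, mul_comm]

theorem aeval_smul_of_isHomogeneous {σ R A : Type*} [CommSemiring R] [CommSemiring A]
    [Algebra R A] {a : MvPolynomial σ R} {n : ℕ} (ha : a.IsHomogeneous n) (t : A) (x : σ → A) :
    aeval (t • x) a = t ^ n * aeval x a := by
  rw [aeval_def, aeval_def, eval₂_eq, eval₂_eq, Finset.mul_sum]
  refine Finset.sum_congr rfl fun m hm => ?_
  simp only [Pi.smul_apply, smul_eq_mul, mul_pow, Finset.prod_mul_distrib,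
    Finset.prod_pow_eq_pow_sum, ← ha.degree_eq_sum_deg_support hm]
  ring

section Polynomial

variable {σ R : Type*} [CommRing R]

theorem homogeneousComponent_mul_left {a : MvPolynomial σ R} {m : ℕ} (ha : a.IsHomogeneous m)
    (b : MvPolynomial σ R) (n : ℕ) :
    homogeneousComponent (m + n) (a * b) = a * homogeneousComponent n b := by
  classical
  have hcomp : ∀ (g : MvPolynomial σ R) (k : ℕ),
      (DirectSum.decompose (homogeneousSubmodule σ R) g k : MvPolynomial σ R)
        = homogeneousComponent k g := fun g k => decomposition.decompose'_apply g k
  rw [← hcomp, ← hcomp]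
  exact DirectSum.coe_decompose_mul_add_of_left_mem _ ha

theorem isHomogeneous_of_mul_left [IsDomain R] {a b : MvPolynomial σ R} {m n : ℕ}
    (ha : a.IsHomogeneous m) (ha0 : a ≠ 0) (hab : (a * b).IsHomogeneous (m + n)) :
    b.IsHomogeneous n := by
  have hb : homogeneousComponent n b = b := mul_left_cancel₀ ha0 <| by
    rw [← homogeneousComponent_mul_left ha, homogeneousComponent_eq_self hab]
  exact hb ▸ homogeneousComponent_isHomogeneous n b

theorem isRelPrime_X_pow [IsDomain R] [UniqueFactorizationMonoid R] {i j : σ} (hij : i ≠ j)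
    (n m : ℕ) : IsRelPrime (X i ^ n : MvPolynomial σ R) (X j ^ m) :=
  IsRelPrime.pow <| X_prime.irreducible.isRelPrime_iff_not_dvd.2 fun h => hij (X_dvd_X.1 h)

theorem exists_eq_of_X_pow_mul_eq {i j k : σ} (hik : i ≠ k) (hjk : j ≠ k) {n : ℕ}
    {a b c : MvPolynomial σ R} (h : X k ^ n * a = X i ^ n * b + X j ^ n * c) :
    ∃ u v, a = X i ^ n * u + X j ^ n * v := by
  have mem_span_iff : ∀ x : MvPolynomial σ R,
      x ∈ Ideal.span ((fun s => monomial s (1 : R)) ''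
        {Finsupp.single i n, Finsupp.single j n}) ↔ ∃ u v, x = X i ^ n * u + X j ^ n * v := by
    intro x
    rw [Set.image_pair, Ideal.mem_span_pair]
    simp only [← X_pow_eq_monomial, mul_comm, eq_comm]
  rw [← mem_span_iff]
  have hmem := (mem_span_iff _).2 ⟨b, c, h⟩
  rw [mem_ideal_span_monomial_image] at hmem ⊢
  intro m hm
  have hm' : Finsupp.single k n + m ∈ (X k ^ n * a).support := by
    rw [mem_support_iff, X_pow_eq_monomial, coeff_monomial_mul, one_mul]
    exact mem_support_iff.1 hm
  obtain ⟨s, hs, hsm⟩ := hmem _ hm'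
  refine ⟨s, hs, ?_⟩
  rcases hs with rfl | rfl
  · simpa [Finsupp.single_le_iff, hik.symm] using hsm
  · simpa [Finsupp.single_le_iff, hjk.symm] using hsm

end Polynomial

variable {F : Type*} [Field F]

local notation "φ" => algebraMap (CoordRing F) (FracField F)

section Charts

variable {I J : Ideal (CoordRing F)} {d : ℕ} {T : Finset (Fin 3)} {y : FracField F}

theorem isHomogeneous_prod_X (T : Finset (Fin 3)) :
    (∏ i ∈ T, X i : CoordRing F).IsHomogeneous T.card := by
  simpa using IsHomogeneous.prod T (fun i => (X i : CoordRing F)) (fun _ => 1)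
    fun i _ => isHomogeneous_X F i

theorem algebraMap_prod_X_ne_zero (T : Finset (Fin 3)) : φ (∏ i ∈ T, X i) ≠ 0 := by
  simp [Finset.prod_eq_zero_iff]

theorem mem_chartSections_of_mul_eq {n : ℕ} {a : CoordRing F} (ha : a ∈ I)
    (had : a.IsHomogeneous (d + n * T.card)) (h : y * φ (∏ i ∈ T, X i) ^ n = φ a) :
    y ∈ chartSections I d T :=
  ⟨n, a, ha, had, by rw [← h, eq_div_iff (pow_ne_zero n (algebraMap_prod_X_ne_zero T))]⟩

theorem eventually_exists_numerator (hy : y ∈ chartSections I d T) :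
    ∀ᶠ n in atTop, ∃ a ∈ I, a.IsHomogeneous (d + n * T.card) ∧
      y * φ (∏ i ∈ T, X i) ^ n = φ a := by
  obtain ⟨N, a, ha, had, rfl⟩ := hy
  filter_upwards [eventually_ge_atTop N] with n hn
  obtain ⟨m, rfl⟩ := Nat.exists_eq_add_of_le hn
  refine ⟨a * (∏ i ∈ T, X i) ^ m, I.mul_mem_right _ ha, ?_, ?_⟩
  · convert had.mul ((isHomogeneous_prod_X T).pow m) using 1
    ring
  · have := algebraMap_prod_X_ne_zero (F := F) T
    rw [map_mul, map_pow, pow_add]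
    field_simp

theorem mem_chartSections_singleton_of_mul_eq {i : Fin 3} {n : ℕ} {a : CoordRing F}
    (ha : a ∈ I) (had : a.IsHomogeneous (d + n)) (h : y * φ (X i ^ n) = φ a) :
    y ∈ chartSections I d {i} :=
  mem_chartSections_of_mul_eq (n := n) ha (by simpa using had) (by simpa using h)

theorem eventually_exists_numerator_singleton {i : Fin 3} (hy : y ∈ chartSections I d {i}) :
    ∀ᶠ n in atTop, ∃ a ∈ I, a.IsHomogeneous (d + n) ∧ y * φ (X i ^ n) = φ a := by
  simpa using eventually_exists_numerator hy

theorem eventually_exists_numerator_pair {i j : Fin 3} (hij : i ≠ j)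
    (hy : y ∈ chartSections I d {i, j}) :
    ∀ᶠ n in atTop, ∃ a ∈ I, a.IsHomogeneous (d + n * 2) ∧
      y * φ (X i ^ n) * φ (X j ^ n) = φ a := by
  simpa [Finset.prod_pair hij, Finset.card_pair hij, mul_pow, mul_assoc] using
    eventually_exists_numerator hy

theorem chartSections_mono_ideal (h : I ≤ J) : chartSections I d T ≤ chartSections J d T := by
  rintro _ ⟨n, a, ha, had, rfl⟩
  exact ⟨n, a, h ha, had, rfl⟩

theorem algebraMap_mem_chartSections {g : CoordRing F} (hg : g ∈ I) (hgd : g.IsHomogeneous d) :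
    φ g ∈ chartSections I d T :=
  ⟨0, g, hg, by simpa using hgd, by simp⟩

theorem mem_chartSections_of_mem_pair (hI : ∀ {u v h : CoordRing F}, IsRelPrime u v →
      u * h ∈ I → v * h ∈ I → h ∈ I) {i j k : Fin 3} (hij : i ≠ j) (hik : i ≠ k) (hjk : j ≠ k)
    (hyi : y ∈ chartSections I d {i, k}) (hyj : y ∈ chartSections I d {j, k}) :
    y ∈ chartSections I d {k} := by
  obtain ⟨n, ⟨a, ha, had, hya⟩, ⟨b, hb, -, hyb⟩⟩ :=
    ((eventually_exists_numerator_pair hik hyi).and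
      (eventually_exists_numerator_pair hjk hyj)).exists
  rw [mul_right_comm] at hya hyb
  have hprime := isRelPrime_X_pow (R := F) hij n n
  have hX : (X i ^ n : CoordRing F) ≠ 0 := pow_ne_zero n (X_ne_zero i)
  obtain ⟨h, hh⟩ := exists_algebraMap_eq_of_isRelPrime hprime hX hya hyb
  rw [hh, ← map_mul, mul_comm, IsFractionRing.injective _ _ |>.eq_iff] at hya hyb
  subst hya hyb
  refine mem_chartSections_singleton_of_mul_eq (hI hprime ha hb) ?_ hh
  refine isHomogeneous_of_mul_left (isHomogeneous_X_pow i n) hX ?_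
  rwa [show n + (d + n) = d + n * 2 by ring]

end Charts

section PrincipalIdeal

variable {g : CoordRing F} {d e : ℕ}

theorem exists_homogeneous_split (hg : g.IsHomogeneous e) {i j : Fin 3} {n m : ℕ}
    {a u v : CoordRing F} (ha : a.IsHomogeneous (n + m))
    (h : a = X i ^ n * (g * u) + X j ^ n * (g * v)) :
    ∃ U ∈ Ideal.span {g}, ∃ V ∈ Ideal.span {g}, U.IsHomogeneous m ∧ V.IsHomogeneous m ∧
      a = X i ^ n * U + X j ^ n * V := by
  have hspan : (Ideal.span {g}).IsHomogeneous (homogeneousSubmodule (Fin 3) F) :=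
    Ideal.homogeneous_span _ _ (by rintro x rfl; exact ⟨e, hg⟩)
  have hmem (w : CoordRing F) : homogeneousComponent m (g * w) ∈ Ideal.span {g} :=
    homogeneousComponent_mem_of_mem hspan
      (Ideal.mul_mem_right _ _ (Ideal.mem_span_singleton_self g)) _
  refine ⟨_, hmem u, _, hmem v, homogeneousComponent_isHomogeneous _ _,
    homogeneousComponent_isHomogeneous _ _, ?_⟩
  rw [← homogeneousComponent_mul_left (isHomogeneous_X_pow _ n),
    ← homogeneousComponent_mul_left (isHomogeneous_X_pow _ n), ← map_add, ← h,
    homogeneousComponent_eq_self ha]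

theorem exists_sub_eq_of_mem_cechCocycles (hg : g.IsHomogeneous e) (hg0 : g ≠ 0)
    {s : Fin 3 → Fin 3 → FracField F} (hs : s ∈ cechCocycles (Ideal.span {g}) d) :
    ∃ y₀ ∈ chartSections (Ideal.span {g}) d {0}, ∃ y₁ ∈ chartSections (Ideal.span {g}) d {1},
      s 0 1 = y₁ - y₀ := by
  obtain ⟨n, ⟨a, ha, had, hsa⟩, ⟨b, hb, -, hsb⟩, ⟨c, hc, -, hsc⟩⟩ :=
    ((eventually_exists_numerator_pair (by decide) (hs.1 0 1)).and
      ((eventually_exists_numerator_pair (by decide) (hs.1 1 2)).and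
        (eventually_exists_numerator_pair (by decide) (hs.1 0 2)))).exists
  obtain ⟨a, rfl⟩ := Ideal.mem_span_singleton.1 ha
  obtain ⟨b, rfl⟩ := Ideal.mem_span_singleton.1 hb
  obtain ⟨c, rfl⟩ := Ideal.mem_span_singleton.1 hc
  have hcocycle : X 2 ^ n * a = X 0 ^ n * (-b) + X 1 ^ n * c := by
    apply mul_left_cancel₀ hg0
    apply IsFractionRing.injective (CoordRing F) (FracField F)
    simp only [map_mul, map_add, map_neg] at hsa hsb hsc ⊢
    linear_combination -φ (X 0 ^ n) * hsb + φ (X 1 ^ n) * hsc - φ (X 2 ^ n) * hsa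
      + hs.2 0 1 2 * (φ (X 0 ^ n) * φ (X 1 ^ n) * φ (X 2 ^ n))
  obtain ⟨u, v, rfl⟩ := exists_eq_of_X_pow_mul_eq (by decide) (by decide) hcocycle
  obtain ⟨U, hU, V, hV, hUd, hVd, hUV⟩ :=
    exists_homogeneous_split hg (i := 0) (j := 1) (n := n) (m := d + n) (u := u) (v := v)
      (by rwa [show n + (d + n) = d + n * 2 by ring]) (by ring)
  have hX (i : Fin 3) : φ (X i ^ n) ≠ 0 := by simp
  refine ⟨-φ V / φ (X 0 ^ n), ?_, φ U / φ (X 1 ^ n), ?_, ?_⟩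
  · exact mem_chartSections_singleton_of_mul_eq (neg_mem hV) hVd.neg
      (by rw [map_neg, div_mul_cancel₀ _ (hX 0)])
  · exact mem_chartSections_singleton_of_mul_eq hU hUd (div_mul_cancel₀ _ (hX 1))
  · rw [hUV, map_add, map_mul, map_mul] at hsa
    field_simp [hX 0, hX 1]
    linear_combination hsa

/-- That is, `H¹(ℙ², 𝒪(d - e)) = 0`. -/
theorem cechCocycles_span_singleton_le (hg : g.IsHomogeneous e) :
    cechCocycles (Ideal.span {g}) d ≤ cechCoboundaries (Ideal.span {g}) d := by
  rintro s ⟨hs, hc⟩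
  obtain rfl | hg0 := eq_or_ne g 0
  · refine ⟨0, fun _ => zero_mem _, fun i j => ?_⟩
    obtain ⟨n, a, ha, -, hsa⟩ := hs i j
    rw [Ideal.span_singleton_zero, Ideal.mem_bot] at ha
    simp [hsa, ha]
  obtain ⟨y₀, hy₀, y₁, hy₁, h01⟩ := exists_sub_eq_of_mem_cechCocycles hg hg0 ⟨hs, hc⟩
  have h00 : s 0 0 = 0 := by simpa using hc 0 0 0
  refine ⟨fun j => s 0 j + y₀, fun j => ?_, fun i j => by linear_combination hc 0 i j⟩
  match j with
  | 0 => simpa only [h00, zero_add] using hy₀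
  | 1 => simpa only [h01, sub_add_cancel] using hy₁
  | 2 =>
    have h02 : s 0 2 + y₀ = s 1 2 + y₁ := by linear_combination h01 - hc 0 1 2
    refine mem_chartSections_of_mem_pair (i := 0) (j := 1) mem_span_singleton_of_isRelPrime
      (by decide) (by decide) (by decide)
      (add_mem (hs 0 2) (chartSections_mono _ _ (by simp) hy₀)) ?_
    simp only [h02]
    exact add_mem (hs 1 2) (chartSections_mono _ _ (by simp) hy₁)

end PrincipalIdeal

section GlobalSections

/-- The space `H⁰(ℙ², Ĩ(d))`, for a saturated ideal `I`: the forms of degree `d` in `I`. -/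
def forms (I : Ideal (CoordRing F)) (d : ℕ) : Submodule F (CoordRing F) :=
  I.restrictScalars F ⊓ homogeneousSubmodule (Fin 3) F d

theorem Subscheme.exists_mem_forms (Z : Subscheme F) {d : ℕ} {y : FracField F}
    (hy : ∀ i, y ∈ chartSections Z.ideal d {i}) : ∃ g ∈ forms Z.ideal d, φ g = y := by
  obtain ⟨n, hn⟩ :=
    (eventually_all.2 fun i => eventually_exists_numerator_singleton (hy i)).exists
  choose a haI had hya using hn
  have hX : (X 0 ^ n : CoordRing F) ≠ 0 := pow_ne_zero n (X_ne_zero 0)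
  obtain ⟨g, rfl⟩ := exists_algebraMap_eq_of_isRelPrime
    (isRelPrime_X_pow (i := (0 : Fin 3)) (j := 1) (by decide) n n) hX (hya 0) (hya 1)
  have ha (i : Fin 3) : X i ^ n * g = a i := by
    apply IsFractionRing.injective (CoordRing F) (FracField F)
    rw [← hya i, map_mul, mul_comm]
  refine ⟨g, ⟨Z.saturated g fun i => ⟨n, ?_⟩, ?_⟩, rfl⟩
  · exact (ha i).symm ▸ haI i
  · refine isHomogeneous_of_mul_left (isHomogeneous_X_pow 0 n) hX ?_
    rw [ha, add_comm]
    exact had 0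

end GlobalSections

section Values

variable {σ : Type*}

/-- The graph of evaluation at `p`, a partially defined map on rational functions: it contains
`(y, v)` when `y` is regular at `p` with value `v` there. -/
def valueGraph (p : σ → F) : Submodule F (FractionRing (MvPolynomial σ F) × F) where
  carrier := {x | ∃ a b : MvPolynomial σ F, eval p b ≠ 0 ∧
    x.1 * algebraMap _ _ b = algebraMap _ _ a ∧ x.2 * eval p b = eval p a}
  zero_mem' := ⟨0, 1, by simp, by simp, by simp⟩
  add_mem' := by
    rintro ⟨x, v⟩ ⟨y, w⟩ ⟨a, b, hb, hx, hv⟩ ⟨a', b', hb', hy, hw⟩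
    refine ⟨a * b' + a' * b, b * b', ?_, ?_, ?_⟩
    · rw [map_mul]
      exact mul_ne_zero hb hb'
    · simp only [map_add, map_mul, Prod.mk_add_mk, ← hx, ← hy]
      ring
    · simp only [map_add, map_mul, Prod.mk_add_mk, ← hv, ← hw]
      ring
  smul_mem' := by
    rintro r ⟨x, v⟩ ⟨a, b, hb, hx, hv⟩
    refine ⟨r • a, b, hb, ?_, ?_⟩
    · rw [Prod.smul_mk, smul_mul_assoc, hx, Algebra.algebraMap_eq_smul_one,
        Algebra.algebraMap_eq_smul_one, smul_assoc]
    · rw [Prod.smul_mk, smul_mul_assoc, hv, smul_eval, smul_eq_mul]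

variable {p : σ → F}

theorem eval_eq_mul_of_mem_valueGraph {y : FractionRing (MvPolynomial σ F)} {v : F}
    (h : (y, v) ∈ valueGraph p) {a b : MvPolynomial σ F}
    (hab : y * algebraMap _ _ b = algebraMap _ _ a) : eval p a = v * eval p b := by
  obtain ⟨a', b', hb', hy, hv⟩ := h
  have hcross : a * b' = a' * b := by
    apply IsFractionRing.injective (MvPolynomial σ F) (FractionRing (MvPolynomial σ F))
    simp only [map_mul, ← hab, ← hy]
    ring
  apply mul_right_cancel₀ hb'
  rw [← map_mul, hcross, map_mul, ← hv]
  ring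

theorem eq_of_mem_valueGraph {y : FractionRing (MvPolynomial σ F)} {v w : F}
    (hv : (y, v) ∈ valueGraph p) (hw : (y, w) ∈ valueGraph p) : v = w := by
  obtain ⟨a, b, hb, hy, hwb⟩ := hw
  exact mul_right_cancel₀ hb ((eval_eq_mul_of_mem_valueGraph hv hy).symm.trans hwb.symm)

theorem algebraMap_mem_valueGraph (p : σ → F) (g : MvPolynomial σ F) :
    (algebraMap _ _ g, eval p g) ∈ valueGraph p :=
  ⟨g, 1, by simp, by simp, by simp⟩

theorem mk_div_mem_valueGraph {a b : MvPolynomial σ F} (hb : eval p b ≠ 0) :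
    (algebraMap _ (FractionRing (MvPolynomial σ F)) a / algebraMap _ _ b, eval p a / eval p b)
      ∈ valueGraph p := by
  refine ⟨a, b, hb, div_mul_cancel₀ _ ?_, div_mul_cancel₀ _ hb⟩
  rw [map_ne_zero_iff _ (IsFractionRing.injective _ _)]
  rintro rfl
  exact hb (map_zero _)

end Values

section ChartValues

variable {I : Ideal (CoordRing F)} {d : ℕ} {T : Finset (Fin 3)} {y : FracField F} {p : Fin 3 → F}

theorem eval_prod_X_pow_ne_zero (hp : ∀ i ∈ T, p i ≠ 0) (n : ℕ) :
    eval p ((∏ i ∈ T, X i) ^ n) ≠ 0 := by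
  rw [map_pow, map_prod]
  exact pow_ne_zero n (Finset.prod_ne_zero_iff.2 fun i hi => by simpa using hp i hi)

theorem exists_mem_valueGraph (hy : y ∈ chartSections I d T) (hp : ∀ i ∈ T, p i ≠ 0) :
    ∃ v, (y, v) ∈ valueGraph p := by
  obtain ⟨n, a, -, -, rfl⟩ := hy
  rw [← map_pow]
  exact ⟨_, mk_div_mem_valueGraph (eval_prod_X_pow_ne_zero hp n)⟩

theorem mk_zero_mem_valueGraph (hI : ∀ a ∈ I, ∀ n, a.IsHomogeneous n → eval p a = 0)
    (hy : y ∈ chartSections I d T) (hp : ∀ i ∈ T, p i ≠ 0) : (y, 0) ∈ valueGraph p := by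
  obtain ⟨n, a, ha, had, rfl⟩ := hy
  rw [← zero_div (eval p ((∏ i ∈ T, X i) ^ n)), ← hI a ha _ had, ← map_pow φ]
  exact mk_div_mem_valueGraph (eval_prod_X_pow_ne_zero hp n)

end ChartValues

section EvaluationCode

variable {f : CoordRing F} {c d : ℕ} {E : Subscheme F}

/-- The space of all families of values, at points with homogeneous coordinates `q k`, of the
forms of degree `d` in `I`. -/
def formValues {κ : Type*} (I : Ideal (CoordRing F)) (d : ℕ) (q : κ → Fin 3 → F) :
    Submodule F (κ → F) :=
  (forms I d).map (LinearMap.pi fun k => (aeval (q k)).toLinearMap)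

theorem mem_formValues {κ : Type*} {I : Ideal (CoordRing F)} {q : κ → Fin 3 → F} {v : κ → F} :
    v ∈ formValues I d q ↔ ∃ g ∈ forms I d, ∀ k, eval (q k) g = v k := by
  simp [formValues, funext_iff]

theorem exists_mk_eq_of_mem_curveSections (hf : f.IsHomogeneous c)
    (hfE : Ideal.span {f} ≤ E.ideal)
    {s : ∀ i : Fin 3, FracField F ⧸ chartSections (Ideal.span {f}) d {i}}
    (hs : s ∈ curveSections f E d) :
    ∃ g ∈ forms E.ideal d, ∀ i, s i = Submodule.Quotient.mk (φ g) := by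
  choose t ht hts using fun i => Submodule.mem_map.1 (hs.1 i)
  have hcocycle : (fun i j => t j - t i) ∈ cechCocycles (Ideal.span {f}) d := by
    refine ⟨fun i j => ?_, fun i j k => by ring⟩
    have hij := hs.2 i j
    simp only [← hts, Submodule.mkQ_apply] at hij
    exact (Submodule.Quotient.eq _).1 hij.symm
  obtain ⟨u, hu, htu⟩ := cechCocycles_span_singleton_le hf hcocycle
  have hglue (i : Fin 3) : t 0 - u 0 = t i - u i := by linear_combination -htu 0 i
  obtain ⟨g, hg, hgt⟩ := E.exists_mem_forms (d := d) (y := t 0 - u 0) fun i =>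
    hglue i ▸ sub_mem (ht i) (chartSections_mono_ideal hfE (hu i))
  refine ⟨g, hg, fun i => ?_⟩
  rw [← hts, Submodule.mkQ_apply, Submodule.Quotient.eq, hgt, hglue i, sub_sub_cancel]
  exact hu i

theorem hasValueAt_mk_algebraMap_iff {g : CoordRing F} (hg : g.IsHomogeneous d) {i : Fin 3}
    {p : Fin 3 → F} (hpi : p i ≠ 0) (hpf : eval p f = 0) {v : F} :
    HasValueAt f d i (Submodule.Quotient.mk (φ g)) p v ↔ eval p g = v := by
  constructor
  · rintro ⟨n, a, -, hga, rfl⟩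
    have hzero : (φ g - φ a / φ (X i) ^ n, 0) ∈ valueGraph p := by
      refine mk_zero_mem_valueGraph (fun b hb _ _ => ?_) ((Submodule.Quotient.eq _).1 hga)
        (by simpa using hpi)
      obtain ⟨b, rfl⟩ := Ideal.mem_span_singleton.1 hb
      rw [map_mul, hpf, zero_mul]
    have hvalue : (φ a / φ (X i ^ n), eval p a / eval p (X i ^ n)) ∈ valueGraph p :=
      mk_div_mem_valueGraph (by simpa using fun h => absurd h hpi)
    have hsum := add_mem hzero hvalue
    rw [map_pow, map_pow, eval_X, Prod.mk_add_mk, sub_add_cancel, zero_add] at hsum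
    exact eq_of_mem_valueGraph (algebraMap_mem_valueGraph p g) hsum
  · rintro rfl
    exact ⟨0, g, hg, by simp, by simp⟩

theorem evaluationCode_eq_formValues {κ : Type*} (hf : f.IsHomogeneous c)
    (hfE : Ideal.span {f} ≤ E.ideal) {q : κ → Fin 3 → F} (hq : ∀ k, q k ≠ 0)
    (hqf : ∀ k, eval (q k) f = 0) : evaluationCode f E d q = formValues E.ideal d q := by
  ext v
  rw [mem_formValues]
  constructor
  · rintro ⟨s, hs, hv⟩
    obtain ⟨g, hg, hsg⟩ := exists_mk_eq_of_mem_curveSections hf hfE hs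
    refine ⟨g, hg, fun k => ?_⟩
    obtain ⟨i, hi⟩ := Function.ne_iff.1 (hq k)
    exact (hasValueAt_mk_algebraMap_iff hg.2 hi (hqf k)).1 (hsg i ▸ hv k i hi)
  · rintro ⟨g, hg, hv⟩
    refine ⟨fun i => Submodule.Quotient.mk (φ g), ⟨fun i => ?_, fun i j => ?_⟩, fun k i hi => ?_⟩
    · exact Submodule.mem_map_of_mem (algebraMap_mem_chartSections hg.1 hg.2)
    · exact (Submodule.factor_mk _ (φ g)).trans (Submodule.factor_mk _ (φ g)).symm
    · exact (hasValueAt_mk_algebraMap_iff hg.2 hi (hqf k)).2 (hv k)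

end EvaluationCode

section Points

/-- The vectors `q P` are homogeneous coordinates of the points `P` of `S`. -/
def IsCoordinates {S : Finset (Point F)} (q : S → Fin 3 → F) : Prop :=
  ∀ P : S, ∃ h : q P ≠ 0, Projectivization.mk F (q P) h = P

theorem mem_pointIdeal_iff_eval_eq_zero {a : CoordRing F} {n : ℕ} (ha : a.IsHomogeneous n)
    (p : Fin 3 → F) : a ∈ pointIdeal p ↔ eval p a = 0 := by
  rw [pointIdeal, RingHom.mem_ker, aeval_line_of_isHomogeneous p ha]
  simp

theorem eval_rep_mk_eq_zero_iff {a : CoordRing F} {n : ℕ} (ha : a.IsHomogeneous n)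
    {p : Fin 3 → F} (hp : p ≠ 0) :
    eval (Projectivization.mk F p hp).rep a = 0 ↔ eval p a = 0 := by
  obtain ⟨t, ht⟩ := Projectivization.exists_smul_eq_mk_rep F p hp
  have hsmul : eval ((t : F) • p) a = (t : F) ^ n * eval p a := by
    simpa using aeval_smul_of_isHomogeneous ha (t : F) p
  rw [← ht, Units.smul_def, hsmul, mul_eq_zero_iff_left (pow_ne_zero n t.ne_zero)]

theorem exists_linear_form {p q : Fin 3 → F} (hp : p ≠ 0) (hq : q ≠ 0)
    (h : Projectivization.mk F p hp ≠ Projectivization.mk F q hq) :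
    ∃ L : CoordRing F, L.IsHomogeneous 1 ∧ eval p L ≠ 0 ∧ eval q L = 0 := by
  by_contra! hL
  have hminor (i j : Fin 3) : q j * p i = q i * p j := by
    have hform : (C (q j) * X i - C (q i) * X j : CoordRing F).IsHomogeneous 1 :=
      (isHomogeneous_C_mul_X _ i).sub (isHomogeneous_C_mul_X _ j)
    by_contra hij
    exact hL _ hform (by simpa [sub_eq_zero] using hij) (by simp [mul_comm])
  obtain ⟨j, hj⟩ := Function.ne_iff.1 hq
  refine h ((Projectivization.mk_eq_mk_iff' F _ _ _ _).2 ⟨p j / q j, funext fun i => ?_⟩)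
  rw [Pi.smul_apply, smul_eq_mul, div_mul_eq_mul_div, div_eq_iff hj, mul_comm (p i), hminor i j,
    mul_comm]

variable {S : Finset (Point F)} {q : S → Fin 3 → F}

theorem IsCoordinates.exists_ne_zero (hq : IsCoordinates q) (P : S) : ∃ i, q P i ≠ 0 :=
  Function.ne_iff.1 (hq P).1

theorem IsCoordinates.exists_form_ne_zero (hq : IsCoordinates q) (P : S) :
    ∃ (n : ℕ) (L : CoordRing F), L.IsHomogeneous n ∧ eval (q P) L ≠ 0 ∧
      ∀ Q ≠ P, eval (q Q) L = 0 := by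
  classical
  have hline : ∀ Q ∈ Finset.univ.erase P, ∃ L : CoordRing F,
      L.IsHomogeneous 1 ∧ eval (q P) L ≠ 0 ∧ eval (q Q) L = 0 := by
    intro Q hQ
    obtain ⟨hP0, hP⟩ := hq P
    obtain ⟨hQ0, hQ'⟩ := hq Q
    refine exists_linear_form hP0 hQ0 ?_
    rw [hP, hQ']
    exact fun h => Finset.ne_of_mem_erase hQ (Subtype.ext h.symm)
  choose! L hLd hLP hLQ using hline
  refine ⟨_, ∏ Q ∈ Finset.univ.erase P, L Q, IsHomogeneous.prod _ _ (fun _ => 1) hLd, ?_,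
    fun Q hQ => ?_⟩
  · rw [map_prod]
    exact Finset.prod_ne_zero_iff.2 hLP
  · have hmem : Q ∈ Finset.univ.erase P := Finset.mem_erase.2 ⟨hQ, Finset.mem_univ Q⟩
    rw [map_prod]
    exact Finset.prod_eq_zero hmem (hLQ Q hmem)

theorem Subscheme.exists_form_eval_ne_zero (Z : Subscheme F) {p : Fin 3 → F}
    (hp : ¬ Z.ideal ≤ pointIdeal p) : ∃ n, ∃ g ∈ forms Z.ideal n, eval p g ≠ 0 := by
  obtain ⟨g, hg, hgp⟩ := Set.not_subset.1 hp
  rw [SetLike.mem_coe, mem_pointIdeal_iff, not_forall] at hgp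
  obtain ⟨n, hn⟩ := hgp
  exact ⟨n, _, ⟨homogeneousComponent_mem_of_mem Z.homogeneous hg n,
    homogeneousComponent_isHomogeneous n g⟩, hn⟩

theorem IsCoordinates.mem_union_ofPoints_iff (hq : IsCoordinates q) (Z : Subscheme F)
    {a : CoordRing F} {n : ℕ} (ha : a.IsHomogeneous n) :
    a ∈ (Z.union (Subscheme.ofPoints S)).ideal ↔ a ∈ Z.ideal ∧ ∀ P, eval (q P) a = 0 := by
  have heval (P : S) : a ∈ pointIdeal (P : Point F).rep ↔ eval (q P) a = 0 := by
    obtain ⟨hP0, hP⟩ := hq P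
    rw [mem_pointIdeal_iff_eval_eq_zero ha, ← hP, eval_rep_mk_eq_zero_iff ha]
  simp only [Subscheme.union, Subscheme.ofPoints, Submodule.mem_inf, Submodule.mem_iInf, ← heval,
    Subtype.forall]

end Points

section ExactSequence

variable {S : Finset (Point F)} {q : S → Fin 3 → F} {Z : Subscheme F} {d : ℕ}

theorem IsCoordinates.mem_chartSections_union_iff (hq : IsCoordinates q) {T : Finset (Fin 3)}
    {y : FracField F} :
    y ∈ chartSections (Z.union (Subscheme.ofPoints S)).ideal d T ↔
      y ∈ chartSections Z.ideal d T ∧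
        ∀ P, (∀ i ∈ T, q P i ≠ 0) → (y, 0) ∈ valueGraph (q P) := by
  refine ⟨fun hy => ⟨chartSections_mono_ideal inf_le_left hy, fun P => mk_zero_mem_valueGraph
    (fun a ha n had => ((hq.mem_union_ofPoints_iff Z had).1 ha).2 P) hy⟩, fun ⟨hy, hvalue⟩ => ?_⟩
  obtain ⟨n, a, ha, had, hya⟩ := (eventually_exists_numerator hy).exists
  have hdeg : (a * ∏ i ∈ T, X i).IsHomogeneous (d + (n + 1) * T.card) := by
    rw [show d + (n + 1) * T.card = d + n * T.card + T.card by ring]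
    exact had.mul (isHomogeneous_prod_X T)
  refine mem_chartSections_of_mul_eq
    ((hq.mem_union_ofPoints_iff Z hdeg).2 ⟨Z.ideal.mul_mem_right _ ha, fun P => ?_⟩) hdeg ?_
  · rw [map_mul, mul_eq_zero, map_prod, Finset.prod_eq_zero_iff, or_iff_not_imp_right]
    intro hT
    rw [← map_pow] at hya
    rw [eval_eq_mul_of_mem_valueGraph (hvalue P fun i hi h => hT ⟨i, hi, by simpa using h⟩) hya,
      zero_mul]
  · rw [pow_succ, ← mul_assoc, hya, map_mul]

theorem IsCoordinates.exists_chartSection_single (hq : IsCoordinates q)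
    (hZ : ∀ P, ¬ Z.ideal ≤ pointIdeal (q P)) (i : Fin 3) (P : S) (v : F) :
    ∃ y ∈ chartSections Z.ideal d {i},
      (q P i ≠ 0 → (y, v) ∈ valueGraph (q P)) ∧
        ∀ Q ≠ P, q Q i ≠ 0 → (y, 0) ∈ valueGraph (q Q) := by
  obtain ⟨m, g, hg, hgP⟩ := Z.exists_form_eval_ne_zero (hZ P)
  obtain ⟨k, L, hL, hLP, hLQ⟩ := hq.exists_form_ne_zero P
  set c := v * q P i ^ (m + k) / (eval (q P) g * eval (q P) L * q P i ^ d) with hc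
  set a := C c * (g * L * X i ^ d) with ha
  have haZ : a ∈ Z.ideal :=
    Z.ideal.mul_mem_left _ (Z.ideal.mul_mem_right _ (Z.ideal.mul_mem_right _ hg.1))
  have had : a.IsHomogeneous (d + (m + k)) := by
    rw [add_comm]
    exact ((hg.2.mul hL).mul (isHomogeneous_X_pow i d)).C_mul c
  have hvalue {Q : S} (hQ : q Q i ≠ 0) : (φ a / φ (X i ^ (m + k)),
      eval (q Q) a / eval (q Q) (X i ^ (m + k))) ∈ valueGraph (q Q) :=
    mk_div_mem_valueGraph (by simpa using fun h => absurd h hQ)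
  refine ⟨φ a / φ (X i ^ (m + k)),
    mem_chartSections_singleton_of_mul_eq haZ had (div_mul_cancel₀ _ (by simp)), fun hP => ?_,
    fun Q hQP hQ => ?_⟩
  · convert hvalue hP
    simp only [ha, hc, map_mul, map_pow, eval_C, eval_X]
    field_simp
  · convert hvalue hQ
    simp [ha, hLQ Q hQP]

theorem IsCoordinates.exists_chartSection (hq : IsCoordinates q)
    (hZ : ∀ P, ¬ Z.ideal ≤ pointIdeal (q P)) (i : Fin 3) (v : S → F) :
    ∃ y ∈ chartSections Z.ideal d {i}, ∀ P, q P i ≠ 0 → (y, v P) ∈ valueGraph (q P) := by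
  classical
  choose y hy hyP hyQ using fun P => hq.exists_chartSection_single (d := d) hZ i P (v P)
  refine ⟨∑ P, y P, sum_mem fun P _ => hy P, fun P hP => ?_⟩
  have hrest : ∑ Q ∈ Finset.univ.erase P, y Q ∈
      (valueGraph (q P)).comap (LinearMap.inl F (FracField F) F) :=
    sum_mem fun Q hQ => hyQ Q P (Finset.ne_of_mem_erase hQ).symm hP
  have hsum := add_mem (hyP P hP) hrest
  rwa [LinearMap.inl_apply, Prod.mk_add_mk, add_zero,
    Finset.add_sum_erase _ _ (Finset.mem_univ P)] at hsum

/-- The Čech differential on `0`-cochains. -/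
def cechDifferential : (Fin 3 → FracField F) →ₗ[F] Fin 3 → Fin 3 → FracField F where
  toFun t i j := t j - t i
  map_add' t u := funext₂ fun i j => add_sub_add_comm (t j) (u j) (t i) (u i)
  map_smul' r t := funext₂ fun i j => (smul_sub r (t j) (t i)).symm

theorem cechDifferential_mem_cechCocycles {I : Ideal (CoordRing F)} {t : Fin 3 → FracField F}
    (ht : ∀ i j, t j - t i ∈ chartSections I d {i, j}) :
    cechDifferential t ∈ cechCocycles I d :=
  ⟨ht, fun i j k => by simp only [cechDifferential, LinearMap.coe_mk, AddHom.coe_mk]; ring⟩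

/-- The Čech `0`-cochains of the ideal sheaf of `Z`, twisted by `d`, whose values at the points
with coordinates `q P` do not depend on the chart, together with these values. -/
def valuedCochains (Z : Subscheme F) (d : ℕ) (q : S → Fin 3 → F) :
    Submodule F ((Fin 3 → FracField F) × (S → F)) where
  carrier := {x | (∀ i, x.1 i ∈ chartSections Z.ideal d {i}) ∧
    ∀ P i, q P i ≠ 0 → (x.1 i, x.2 P) ∈ valueGraph (q P)}
  zero_mem' := ⟨fun _ => zero_mem _, fun _ _ _ => zero_mem _⟩
  add_mem' := fun hx hy => ⟨fun i => add_mem (hx.1 i) (hy.1 i),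
    fun P i hi => add_mem (hx.2 P i hi) (hy.2 P i hi)⟩
  smul_mem' := fun r _ hx => ⟨fun i => Submodule.smul_mem _ r (hx.1 i),
    fun P i hi => Submodule.smul_mem _ r (hx.2 P i hi)⟩

theorem IsCoordinates.cechDifferential_mem (hq : IsCoordinates q) (x : valuedCochains Z d q) :
    cechDifferential x.1.1 ∈ cechCocycles (Z.union (Subscheme.ofPoints S)).ideal d := by
  obtain ⟨⟨t, v⟩, ht, hv⟩ := x
  refine cechDifferential_mem_cechCocycles fun i j => hq.mem_chartSections_union_iff.2
    ⟨sub_mem (chartSections_mono _ _ (by simp) (ht j)) (chartSections_mono _ _ (by simp) (ht i)),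
      fun P hP => ?_⟩
  simpa using sub_mem (hv P j (hP j (by simp))) (hv P i (hP i (by simp)))

/-- The map `H⁰(S, 𝒪_S) → H¹(ℙ², I_{Z ∪ S}(d))` of the long exact sequence, defined on the
cochains that lift a function on `S`. -/
def IsCoordinates.connectingMap (hq : IsCoordinates q) (Z : Subscheme F) (d : ℕ) :
    valuedCochains Z d q →ₗ[F] H1 (Z.union (Subscheme.ofPoints S)) d :=
  Submodule.mkQ _ ∘ₗ LinearMap.codRestrict _
    (cechDifferential ∘ₗ LinearMap.fst F _ _ ∘ₗ Submodule.subtype _) hq.cechDifferential_mem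

theorem IsCoordinates.connectingMap_eq_zero_iff (hq : IsCoordinates q)
    (x : valuedCochains Z d q) :
    hq.connectingMap Z d x = 0 ↔ x.1.2 ∈ formValues Z.ideal d q := by
  obtain ⟨⟨t, v⟩, ht, hv⟩ := x
  refine (Submodule.Quotient.mk_eq_zero _).trans ?_
  rw [mem_formValues]
  constructor
  · rintro ⟨u, hu, htu : ∀ i j, t j - t i = u j - u i⟩
    have huZ (i : Fin 3) := hq.mem_chartSections_union_iff.1 (hu i)
    have hglue (i : Fin 3) : t 0 - u 0 = t i - u i := by linear_combination -htu 0 i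
    obtain ⟨g, hg, hgt⟩ := Z.exists_mem_forms (d := d) (y := t 0 - u 0) fun i =>
      hglue i ▸ sub_mem (ht i) (huZ i).1
    refine ⟨g, hg, fun P => ?_⟩
    obtain ⟨i, hi⟩ := hq.exists_ne_zero P
    have hvalue := sub_mem (hv P i hi) ((huZ i).2 P (by simpa using hi))
    refine eq_of_mem_valueGraph (algebraMap_mem_valueGraph (q P) g) ?_
    simpa [hgt, hglue i] using hvalue
  · rintro ⟨g, hg, hgv⟩
    refine ⟨fun i => t i - φ g, fun i => hq.mem_chartSections_union_iff.2
      ⟨sub_mem (ht i) (algebraMap_mem_chartSections hg.1 hg.2), fun P hP => ?_⟩,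
      fun i j => (sub_sub_sub_cancel_right _ _ _).symm⟩
    simpa [hgv] using sub_mem (hv P i (hP i (by simp))) (algebraMap_mem_valueGraph (q P) g)

theorem IsCoordinates.exists_valuedCochain (hq : IsCoordinates q)
    (hZ : ∀ P, ¬ Z.ideal ≤ pointIdeal (q P)) (v : S → F) :
    ∃ x : valuedCochains Z d q, x.1.2 = v := by
  choose t ht hv using fun i => hq.exists_chartSection (d := d) hZ i v
  exact ⟨⟨⟨t, v⟩, ht, fun P i => hv i P⟩, rfl⟩

theorem cechCocycles_mono {I J : Ideal (CoordRing F)} (h : I ≤ J) :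
    cechCocycles I d ≤ cechCocycles J d :=
  fun _ hs => ⟨fun i j => chartSections_mono_ideal h (hs.1 i j), hs.2⟩

theorem cechCoboundaries_mono {I J : Ideal (CoordRing F)} (h : I ≤ J) :
    cechCoboundaries I d ≤ cechCoboundaries J d :=
  fun _ ⟨t, ht, hs⟩ => ⟨t, fun i => chartSections_mono_ideal h (ht i), hs⟩

/-- The map `H¹(ℙ², I_W(d)) → H¹(ℙ², I_Z(d))` induced by an inclusion `Z ⊆ W`. -/
def h1Map {W Z : Subscheme F} (h : W.ideal ≤ Z.ideal) (d : ℕ) : H1 W d →ₗ[F] H1 Z d :=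
  Submodule.mapQ _ _ (Submodule.inclusion (cechCocycles_mono h)) fun _ hs =>
    cechCoboundaries_mono h hs

theorem IsCoordinates.range_connectingMap (hq : IsCoordinates q) :
    LinearMap.range (hq.connectingMap Z d) =
      LinearMap.ker (h1Map (W := Z.union (Subscheme.ofPoints S)) inf_le_left d) := by
  refine le_antisymm ?_ fun z hz => ?_
  · rintro _ ⟨x, rfl⟩
    exact (Submodule.Quotient.mk_eq_zero _).2 ⟨x.1.1, x.2.1, fun _ _ => rfl⟩
  · obtain ⟨⟨s, hs⟩, rfl⟩ := Submodule.mkQ_surjective _ z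
    obtain ⟨t, ht, hst : ∀ i j, s i j = t j - t i⟩ := (Submodule.Quotient.mk_eq_zero _).1 hz
    choose i₀ hi₀ using hq.exists_ne_zero
    choose v hv using fun P =>
      exists_mem_valueGraph (p := q P) (ht (i₀ P)) (by simpa using hi₀ P)
    refine ⟨⟨⟨t, v⟩, ht, fun P i hi => ?_⟩, congrArg (Submodule.mkQ _) (Subtype.ext ?_)⟩
    · have hzero := (hq.mem_chartSections_union_iff.1 (hs.1 (i₀ P) i)).2 P
        (by simpa [hi] using hi₀ P)
      simpa [hst] using add_mem hzero (hv P)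
    · exact funext₂ fun i j => (hst i j).symm

theorem IsCoordinates.h1Map_surjective (hq : IsCoordinates q)
    (hZ : ∀ P, ¬ Z.ideal ≤ pointIdeal (q P)) :
    Function.Surjective (h1Map (W := Z.union (Subscheme.ofPoints S)) (Z := Z) inf_le_left d) := by
  intro z
  obtain ⟨⟨s, hs⟩, rfl⟩ := Submodule.mkQ_surjective _ z
  choose i₀ hi₀ using hq.exists_ne_zero
  have hsvalue (i : Fin 3) (P : S) : ∃ v, q P i ≠ 0 → (s (i₀ P) i, v) ∈ valueGraph (q P) := by
    by_cases hi : q P i = 0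
    · exact ⟨0, fun h => absurd hi h⟩
    · obtain ⟨v, hv⟩ := exists_mem_valueGraph (p := q P) (hs.1 (i₀ P) i) (by simpa [hi] using hi₀ P)
      exact ⟨v, fun _ => hv⟩
  choose v hv using hsvalue
  choose t ht htv using fun i => hq.exists_chartSection (d := d) hZ i (v i)
  have hδ : cechDifferential t ∈ cechCocycles Z.ideal d :=
    cechDifferential_mem_cechCocycles fun i j =>
      sub_mem (chartSections_mono _ _ (by simp) (ht j)) (chartSections_mono _ _ (by simp) (ht i))
  have hsub := sub_mem hs hδ
  refine ⟨Submodule.Quotient.mk ⟨s - cechDifferential t, fun i j =>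
    hq.mem_chartSections_union_iff.2 ⟨hsub.1 i j, fun P hP => ?_⟩, hsub.2⟩, ?_⟩
  · have hi := hP i (by simp)
    have hj := hP j (by simp)
    have hij : (s - cechDifferential t) i j = s (i₀ P) j - s (i₀ P) i - (t j - t i) := by
      change s i j - (t j - t i) = _
      linear_combination hs.2 (i₀ P) i j
    rw [hij]
    simpa using sub_mem (sub_mem (hv j P hj) (hv i P hi)) (sub_mem (htv j P hj) (htv i P hi))
  · refine (Submodule.Quotient.eq _).2 (neg_mem_iff.1 ⟨t, ht, fun i j => ?_⟩)
    change -(s i j - (t j - t i) - s i j) = t j - t i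
    ring

/-- The isomorphism given by the exactness of
`H⁰(ℙ², I_Z(d)) → H⁰(S, 𝒪_S) → H¹(ℙ², I_{Z ∪ S}(d)) → H¹(ℙ², I_Z(d))`. -/
def IsCoordinates.kerH1MapEquiv (hq : IsCoordinates q)
    (hZ : ∀ P, ¬ Z.ideal ≤ pointIdeal (q P)) :
    LinearMap.ker (h1Map (W := Z.union (Subscheme.ofPoints S)) (Z := Z) inf_le_left d) ≃ₗ[F]
      (S → F) ⧸ formValues Z.ideal d q :=
  LinearEquiv.symm <|
  (LinearMap.quotKerEquivOfSurjective ((formValues Z.ideal d q).mkQ ∘ₗ LinearMap.snd F _ _ ∘ₗ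
    (valuedCochains Z d q).subtype) ((Submodule.mkQ_surjective _).comp
      fun v => hq.exists_valuedCochain hZ v)).symm ≪≫ₗ
  Submodule.quotEquivOfEq _ _ (by
    ext x
    exact (Submodule.Quotient.mk_eq_zero _).trans (hq.connectingMap_eq_zero_iff x).symm) ≪≫ₗ
  (hq.connectingMap Z d).quotKerEquivRange ≪≫ₗ LinearEquiv.ofEq _ _ hq.range_connectingMap

theorem IsCoordinates.h1_union_ofPoints (hq : IsCoordinates q)
    (hZ : ∀ P, ¬ Z.ideal ≤ pointIdeal (q P)) [Module.Finite F (H1 Z d)] :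
    h1 (Z.union (Subscheme.ofPoints S)) d =
      h1 Z d + Module.finrank F ((S → F) ⧸ formValues Z.ideal d q) := by
  set ρ := h1Map (W := Z.union (Subscheme.ofPoints S)) (Z := Z) inf_le_left d
  have hker : LinearMap.ker ρ ≃ₗ[F] (S → F) ⧸ formValues Z.ideal d q := hq.kerH1MapEquiv hZ
  have hquot := ρ.quotKerEquivOfSurjective (hq.h1Map_surjective hZ)
  have := Module.Finite.equiv hker.symm
  have := Module.Finite.equiv hquot.symm
  have := Module.Finite.of_submodule_quotient (LinearMap.ker ρ)
  rw [h1, h1, ← hker.finrank_eq, ← hquot.finrank_eq, Submodule.finrank_quotient_add_finrank]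

end ExactSequence

section FiniteDimensional

variable {K V : Type*} [Field K] [AddCommGroup V] [Module K V]

theorem exists_fg_sup_eq_top (N : Submodule K V) [Module.Finite K (V ⧸ N)] :
    ∃ M : Submodule K V, M.FG ∧ N ⊔ M = ⊤ := by
  obtain ⟨M, hM⟩ := N.exists_isCompl
  exact ⟨M, Module.Finite.iff_fg.1 (Module.Finite.equiv (N.quotientEquivOfIsCompl M hM)),
    hM.sup_eq_top⟩

theorem finite_quotient_comap_of_le_sup {A B N : Submodule K V} (hN : N.FG) (h : A ≤ B ⊔ N) :
    Module.Finite K (A ⧸ B.comap A.subtype) := by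
  have hrange : LinearMap.range (B.mkQ ∘ₗ A.subtype) ≤ N.map B.mkQ := by
    rw [LinearMap.range_comp, Submodule.range_subtype]
    refine (Submodule.map_mono h).trans ?_
    rw [Submodule.map_sup, Submodule.mkQ_map_self, bot_sup_eq]
  have := Module.Finite.iff_fg.2 (hN.map B.mkQ)
  have := Submodule.finiteDimensional_of_le hrange
  have e := (B.mkQ ∘ₗ A.subtype).quotKerEquivRange
  rw [LinearMap.ker_comp, Submodule.ker_mkQ] at e
  exact Module.Finite.equiv e.symm

end FiniteDimensional

section ZeroDimensional

theorem specializes_symm_of_topologicalKrullDim_nonpos {T : Type*} [TopologicalSpace T]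
    (h : topologicalKrullDim T ≤ 0) {x y : T} (hxy : x ⤳ y) : y ⤳ x := by
  let pointClosure (z : T) : TopologicalSpace.IrreducibleCloseds T :=
    ⟨closure {z}, isIrreducible_singleton.closure, isClosed_closure⟩
  have hle : pointClosure y ≤ pointClosure x := hxy.closure_subset
  exact specializes_iff_mem_closure.2
    (Order.krullDim_nonpos_iff_forall_isMax.1 h _ hle (subset_closure rfl))

theorem exists_isHomogeneous_sub_mem {σ R : Type*} [CommRing R] (i : σ) (g : MvPolynomial σ R) :
    ∃ n, ∃ G : MvPolynomial σ R, G.IsHomogeneous n ∧ G - g ∈ Ideal.span {X i - 1} := by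
  set N := g.totalDegree
  refine ⟨N, ∑ n ∈ Finset.range (N + 1), homogeneousComponent n g * X i ^ (N - n),
    IsHomogeneous.sum _ _ _ fun n hn => ?_, ?_⟩
  · convert (homogeneousComponent_isHomogeneous n g).mul (isHomogeneous_X_pow i (N - n)) using 1
    have := Finset.mem_range.1 hn
    omega
  · have hdiff : ∑ n ∈ Finset.range (N + 1), homogeneousComponent n g * X i ^ (N - n) - g =
        ∑ n ∈ Finset.range (N + 1), homogeneousComponent n g * (X i ^ (N - n) - 1) := by
      simp only [mul_sub, mul_one, Finset.sum_sub_distrib, N, sum_homogeneousComponent]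
    rw [hdiff, Ideal.mem_span_singleton]
    exact Finset.dvd_sum fun n _ => Dvd.dvd.mul_left (sub_one_dvd_pow_sub_one (X i) (N - n)) _

variable {Z : Subscheme F} {i : Fin 3} {P Q : Ideal (CoordRing F)}

theorem le_of_homogeneousCore_le (hP : X i - 1 ∈ P) (hQ : X i - 1 ∈ Q)
    (h : Q.homogeneousCore (homogeneousSubmodule (Fin 3) F) ≤
      P.homogeneousCore (homogeneousSubmodule (Fin 3) F)) : Q ≤ P := by
  intro g hg
  obtain ⟨n, G, hG, hGg⟩ := exists_isHomogeneous_sub_mem i g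
  have hle {J : Ideal (CoordRing F)} (hJ : X i - 1 ∈ J) : G - g ∈ J :=
    (Ideal.span_singleton_le_iff_mem J).2 hJ hGg
  have hGQ : G ∈ Q := (Submodule.sub_mem_iff_left Q hg).1 (hle hQ)
  have hGP : G ∈ P := Ideal.toIdeal_homogeneousCore_le _ P
    (h (Ideal.mem_homogeneousCore_of_homogeneous_of_mem ⟨n, hG⟩ hGQ))
  exact (Submodule.sub_mem_iff_right P hGP).1 (hle hP)

/-- The point of `Z` under a point `P` of the affine cone over `Z` outside the plane `xᵢ = 0`. -/
def Subscheme.supportPoint (Z : Subscheme F) (P : Ideal (CoordRing F)) [hP : P.IsPrime]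
    (hZP : Z.ideal ≤ P) (hXP : X i ∉ P) : Z.support :=
  ⟨⟨P.homogeneousCore (homogeneousSubmodule (Fin 3) F), hP.homogeneousCore, fun h =>
      hXP (Ideal.toIdeal_homogeneousCore_le _ P
        (h (HomogeneousIdeal.mem_irrelevant_of_mem _ one_pos (isHomogeneous_X F i))))⟩,
    Z.homogeneous.toIdeal_homogeneousCore_eq_self.symm.le.trans
      (Ideal.homogeneousCore_mono _ hZP)⟩

theorem Subscheme.IsZeroDimensional.homogeneousCore_le (hZ : Z.IsZeroDimensional)
    [P.IsPrime] [Q.IsPrime] (hZP : Z.ideal ≤ P) (hPQ : P ≤ Q) (hXQ : X i ∉ Q) :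
    Q.homogeneousCore (homogeneousSubmodule (Fin 3) F) ≤
      P.homogeneousCore (homogeneousSubmodule (Fin 3) F) := by
  have specializes_iff (x y : Z.support) : x ⤳ y ↔ x.1 ≤ y.1 := by
    rw [subtype_specializes_iff, specializes_iff_mem_closure,
      ProjectiveSpectrum.le_iff_mem_closure]
  exact (specializes_iff (Z.supportPoint Q (hZP.trans hPQ) hXQ)
    (Z.supportPoint P hZP fun h => hXQ (hPQ h))).1
      (specializes_symm_of_topologicalKrullDim_nonpos hZ
        ((specializes_iff _ _).2 (Ideal.homogeneousCore_mono _ hPQ)))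

theorem Subscheme.IsZeroDimensional.finite_quotient (hZ : Z.IsZeroDimensional) (i : Fin 3) :
    Module.Finite F (CoordRing F ⧸ (Z.ideal ⊔ Ideal.span {X i - 1})) := by
  rw [Module.finite_iff_krullDimLE_zero, Ring.krullDimLE_zero_iff]
  intro P hP
  obtain ⟨M, hM, hPM⟩ := P.exists_le_maximal hP.ne_top
  have hprime := hM.isPrime
  suffices M ≤ P from le_antisymm hPM this ▸ hM
  rw [← Ideal.comap_le_comap_iff_of_surjective _ Ideal.Quotient.mk_surjective]
  have hle (J : Ideal (CoordRing F ⧸ (Z.ideal ⊔ Ideal.span {X i - 1}))) :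
      Z.ideal ⊔ Ideal.span {X i - 1} ≤ J.comap (Ideal.Quotient.mk _) :=
    Ideal.mk_ker.ge.trans (Ideal.comap_mono bot_le)
  have hX (J : Ideal (CoordRing F ⧸ (Z.ideal ⊔ Ideal.span {X i - 1}))) :
      X i - 1 ∈ J.comap (Ideal.Quotient.mk _) :=
    (Ideal.span_singleton_le_iff_mem _).1 (le_sup_right.trans (hle J))
  refine le_of_homogeneousCore_le (hX P) (hX M)
    (hZ.homogeneousCore_le (i := i) (le_sup_left.trans (hle P)) (Ideal.comap_mono hPM) fun h => ?_)
  exact (hprime.comap (Ideal.Quotient.mk _)).ne_top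
    ((Ideal.eq_top_iff_one _).2 (by simpa using sub_mem h (hX M)))

/-- The map `g ↦ xᵢ ^ d * g (x₀ / xᵢ, x₁ / xᵢ, x₂ / xᵢ)`, which identifies the polynomials modulo
`xᵢ - 1` with the sections of `𝒪(d)` over the chart `xᵢ ≠ 0`. -/
def dehomogenization (d : ℕ) (i : Fin 3) : CoordRing F →ₗ[F] FracField F :=
  LinearMap.mulLeft F (φ (X i) ^ d) ∘ₗ
    (aeval ((φ (X i))⁻¹ • fun j => φ (X j)) : CoordRing F →ₐ[F] FracField F).toLinearMap

theorem dehomogenization_apply (d : ℕ) (i : Fin 3) (g : CoordRing F) :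
    dehomogenization d i g =
      φ (X i) ^ d * aeval ((φ (X i))⁻¹ • fun j => φ (X j)) g := rfl

variable {d : ℕ}

theorem dehomogenization_of_isHomogeneous {a : CoordRing F} {n : ℕ} (ha : a.IsHomogeneous n) :
    dehomogenization d i a * φ (X i ^ n) = φ (X i ^ d * a) := by
  have haeval : aeval (fun j => φ (X j)) a = φ a := by
    simpa [Function.comp_def] using
      aeval_algebraMap_apply (FracField F) (X : Fin 3 → CoordRing F) a
  have hX : φ (X i) ≠ 0 := by simp
  rw [dehomogenization_apply, aeval_smul_of_isHomogeneous ha, haeval, map_pow, map_mul, map_pow,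
    inv_pow]
  field_simp

theorem dehomogenization_mem_chartSections (Z : Subscheme F) {g : CoordRing F}
    (hg : g ∈ Z.ideal ⊔ Ideal.span {X i - 1}) :
    dehomogenization d i g ∈ chartSections Z.ideal d {i} := by
  obtain ⟨a, ha, b, hb, rfl⟩ := Submodule.mem_sup.1 hg
  obtain ⟨b, rfl⟩ := Ideal.mem_span_singleton.1 hb
  have hzero : dehomogenization d i ((X i - 1) * b) = 0 := by
    rw [dehomogenization_apply, map_mul, map_sub, aeval_X]
    simp
  rw [map_add, hzero, add_zero, ← sum_homogeneousComponent a, map_sum]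
  refine sum_mem fun n _ => ?_
  have hn := homogeneousComponent_isHomogeneous n a
  exact mem_chartSections_singleton_of_mul_eq
    (Z.ideal.mul_mem_left _ (homogeneousComponent_mem_of_mem Z.homogeneous ha n))
    ((isHomogeneous_X_pow i d).mul hn) (dehomogenization_of_isHomogeneous hn)

theorem chartSections_le_range_dehomogenization (I : Ideal (CoordRing F)) :
    chartSections I d {i} ≤ LinearMap.range (dehomogenization d i) := by
  intro y hy
  obtain ⟨n, a, -, had, hya⟩ := (eventually_exists_numerator_singleton hy).exists
  have hX : φ (X i) ≠ 0 := by simp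
  refine ⟨a, mul_right_cancel₀ (pow_ne_zero (d + n) hX) ?_⟩
  rw [← map_pow, dehomogenization_of_isHomogeneous had, map_mul, ← hya]
  simp only [map_pow]
  ring

theorem Subscheme.IsZeroDimensional.exists_fg_sup (hZ : Z.IsZeroDimensional) (d : ℕ)
    (i : Fin 3) : ∃ N : Submodule F (FracField F), N.FG ∧
      chartSections ⊤ d {i} ≤ chartSections Z.ideal d {i} ⊔ N := by
  set J := (Z.ideal ⊔ Ideal.span {X i - 1}).restrictScalars F
  have : Module.Finite F (CoordRing F ⧸ J) := hZ.finite_quotient i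
  obtain ⟨M, hM, htop⟩ := exists_fg_sup_eq_top J
  refine ⟨M.map (dehomogenization d i), hM.map _,
    (chartSections_le_range_dehomogenization ⊤).trans ?_⟩
  rw [LinearMap.range_eq_map, ← htop, Submodule.map_sup]
  exact sup_le_sup_right
    (Submodule.map_le_iff_le_comap.2 fun _ => dehomogenization_mem_chartSections Z) _

theorem Subscheme.IsZeroDimensional.finite_H1 (hZ : Z.IsZeroDimensional) (d : ℕ) :
    Module.Finite F (H1 Z d) := by
  choose N hN hle using hZ.exists_fg_sup d
  refine finite_quotient_comap_of_le_sup (N := (Submodule.pi Set.univ N).map cechDifferential)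
    ((Submodule.fg_pi hN).map _) fun s hs => ?_
  obtain ⟨t, ht, hst⟩ := cechCocycles_span_singleton_le (isHomogeneous_one (Fin 3) F)
    (cechCocycles_mono (by rw [Ideal.span_singleton_one]; exact le_top) hs)
  rw [Ideal.span_singleton_one] at ht
  choose a ha b hb hab using fun i => Submodule.mem_sup.1 (hle i (ht i))
  refine Submodule.mem_sup.2 ⟨cechDifferential a, ⟨a, ha, fun _ _ => rfl⟩, cechDifferential b,
    Submodule.mem_map_of_mem fun i _ => hb i, ?_⟩
  rw [← map_add, show a + b = t from funext hab]
  exact funext₂ fun i j => (hst i j).symm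

end ZeroDimensional
section Codes

variable {κ : Type*}

/-- The shortened code: the words of `D` that vanish outside `T`, still indexed by `κ`. -/
def shortening (D : Submodule F (κ → F)) (T : Set κ) : Submodule F (κ → F) :=
  D ⊓ Submodule.pi Tᶜ fun _ => ⊥

theorem mem_shortening {D : Submodule F (κ → F)} {T : Set κ} {v : κ → F} :
    v ∈ shortening D T ↔ v ∈ D ∧ ∀ k ∉ T, v k = 0 := by
  simp [shortening, Submodule.mem_pi]

theorem shortening_mono (D : Submodule F (κ → F)) {T T' : Set κ} (h : T ⊆ T') :
    shortening D T ≤ shortening D T' :=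
  fun _ hv => mem_shortening.2 ((mem_shortening.1 hv).imp_right fun hvT k hk =>
    hvT k fun hkT => hk (h hkT))

variable [Fintype κ]

theorem finrank_quotient_eq_finrank_dualCode (C : Submodule F (κ → F)) :
    Module.finrank F ((κ → F) ⧸ C) = Module.finrank F (dualCode C) := by
  classical
  have hdual : dualCode C =
      C.dualAnnihilator.comap (dotProductEquiv F κ : (κ → F) →ₗ[F] Module.Dual F (κ → F)) := by
    ext v
    simp [dualCode, Submodule.mem_dualAnnihilator]
  rw [hdual, ((dotProductEquiv F κ).ofSubmodule' C.dualAnnihilator).finrank_eq,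
    ← C.dualQuotEquivDualAnnihilator.finrank_eq, Subspace.dual_finrank_eq]

theorem shortening_dualCode {ι : Type*} [Fintype ι] {e : ι → κ} (he : Function.Injective e)
    (C : Submodule F (κ → F)) :
    shortening (dualCode C) (Set.range e) =
      (dualCode (C.map (LinearMap.funLeft F F e))).map (Function.ExtendByZero.linearMap F e) := by
  have hdot {v : κ → F} (hv : ∀ k ∉ Set.range e, v k = 0) (c : κ → F) :
      v ∘ e ⬝ᵥ LinearMap.funLeft F F e c = v ⬝ᵥ c :=
    Fintype.sum_of_injective e he _ _ (fun k hk => by rw [hv k hk, zero_mul]) fun _ => rfl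
  ext v
  rw [mem_shortening]
  constructor
  · rintro ⟨hvC, hv⟩
    refine ⟨v ∘ e, ?_, funext fun k => ?_⟩
    · rintro _ ⟨c, hc, rfl⟩
      exact (hdot hv c).trans (hvC c hc)
    · by_cases hk : k ∈ Set.range e
      · obtain ⟨i, rfl⟩ := hk
        exact he.extend_apply _ _ i
      · exact (Function.extend_apply' _ _ k hk).trans (hv k hk).symm
  · rintro ⟨u, hu, rfl⟩
    have hvanish : ∀ k ∉ Set.range e, Function.ExtendByZero.linearMap F e u k = 0 :=
      fun k hk => Function.extend_apply' _ _ k hk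
    have hrestrict : Function.ExtendByZero.linearMap F e u ∘ e = u := Function.extend_comp he u 0
    refine ⟨fun c hc => ?_, hvanish⟩
    rw [← hdot hvanish, hrestrict]
    exact hu _ (Submodule.mem_map_of_mem hc)

theorem finrank_shortening_dualCode {ι : Type*} [Finite ι] {e : ι → κ}
    (he : Function.Injective e) (C : Submodule F (κ → F)) :
    Module.finrank F (shortening (dualCode C) (Set.range e)) =
      Module.finrank F ((ι → F) ⧸ C.map (LinearMap.funLeft F F e)) := by
  have := Fintype.ofFinite ι
  have hinj : Function.Injective (Function.ExtendByZero.linearMap F e) :=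
    Function.LeftInverse.injective (g := (· ∘ e)) fun u => Function.extend_comp he u 0
  rw [shortening_dualCode he, finrank_quotient_eq_finrank_dualCode,
    (Submodule.equivMapOfInjective _ hinj _).finrank_eq]

theorem minDist_le_weight {D : Submodule F (κ → F)} {v : κ → F} (hv : v ∈ D) (hv0 : v ≠ 0) :
    minDist D ≤ weight v :=
  (iInf₂_le v hv).trans ((iInf₂_le 0 D.zero_mem).trans (iInf_le _ hv0))

theorem ne_zero_of_weight_eq_minDist {D : Submodule F (κ → F)} {v : κ → F}
    (hv : (weight v : ℕ∞) = minDist D) : v ≠ 0 := by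
  classical
  rintro rfl
  have hpos : 1 ≤ minDist D :=
    le_iInf₂ fun v _ => le_iInf₂ fun w _ => le_iInf fun hvw => by
      exact_mod_cast hammingDist_pos.2 hvw
  rw [← hv] at hpos
  simp [weight] at hpos

variable {B S T : Finset (Point F)} {v : B → F} {D : Submodule F (B → F)}

theorem exists_hasSupport (v : B → F) : ∃ S, HasSupport v S := by
  classical
  refine ⟨{P | v P ≠ 0}.toFinset.map (Function.Embedding.subtype _), ?_, fun P => by simp⟩
  intro P hP
  obtain ⟨Q, -, rfl⟩ := Finset.mem_map.1 hP
  exact Q.2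

theorem HasSupport.weight_eq (h : HasSupport v S) : weight v = S.card := by
  classical
  refine Finset.card_bij (fun P _ => (P : Point F)) (fun P hP => ?_) (fun _ _ _ _ => Subtype.ext)
    fun P hP => ⟨⟨P, h.1 hP⟩, ?_, rfl⟩
  · exact (h.2 P).1 (by simpa using hP)
  · simpa using (h.2 ⟨P, h.1 hP⟩).2 hP

theorem HasSupport.mem_shortening_iff (h : HasSupport v T) :
    v ∈ shortening D {P | ↑P ∈ S} ↔ v ∈ D ∧ T ⊆ S := by
  rw [mem_shortening]
  refine and_congr_right fun _ => ⟨fun hv P hP => ?_, fun hTS P hP => ?_⟩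
  · by_contra hPS
    exact (h.2 ⟨P, h.1 hP⟩).2 hP (hv ⟨P, h.1 hP⟩ hPS)
  · by_contra hvP
    exact hP (hTS ((h.2 P).1 hvP))

theorem HasSupport.shortening_ne_bot (h : HasSupport v S) (hv : v ∈ D) (hv0 : v ≠ 0) :
    shortening D {P | ↑P ∈ S} ≠ ⊥ :=
  (Submodule.ne_bot_iff _).2 ⟨v, h.mem_shortening_iff.2 ⟨hv, subset_rfl⟩, hv0⟩

theorem exists_hasSupport_subset (h : shortening D {P | ↑P ∈ S} ≠ ⊥) :
    ∃ v ∈ D, v ≠ 0 ∧ ∃ T ⊆ S, HasSupport v T := by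
  obtain ⟨v, hv, hv0⟩ := Submodule.exists_mem_ne_zero_of_ne_bot h
  obtain ⟨T, hT⟩ := exists_hasSupport v
  exact ⟨v, (hT.mem_shortening_iff.1 hv).1, hv0, T, (hT.mem_shortening_iff.1 hv).2, hT⟩

theorem minDist_eq_iInf_card (D : Submodule F (B → F)) :
    minDist D = ⨅ (S : Finset (Point F)) (_ : S ⊆ B) (_ : shortening D {P | ↑P ∈ S} ≠ ⊥),
      (S.card : ℕ∞) := by
  apply le_antisymm
  · refine le_iInf₂ fun S _ => le_iInf fun hne => ?_
    obtain ⟨v, hv, hv0, T, hTS, hT⟩ := exists_hasSupport_subset hne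
    calc minDist D ≤ weight v := minDist_le_weight hv hv0
      _ = T.card := by rw [hT.weight_eq]
      _ ≤ S.card := by exact_mod_cast Finset.card_le_card hTS
  · refine le_iInf₂ fun v hv => le_iInf₂ fun w hw => le_iInf fun hvw => ?_
    obtain ⟨T, hT⟩ := exists_hasSupport (-v + w)
    have hne := hT.shortening_ne_bot (add_mem (neg_mem hv) hw) fun h => hvw (neg_add_eq_zero.1 h)
    classical
    calc _ ≤ (T.card : ℕ∞) := (iInf₂_le T hT.1).trans (iInf_le _ hne)
      _ = hammingDist v w := by rw [← hT.weight_eq, hammingDist_eq_hammingNorm, weight]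

theorem HasSupport.shortening_lt (h : HasSupport v S) (hv : v ∈ D) (hT : T ⊂ S) :
    shortening D {P | ↑P ∈ T} < shortening D {P | ↑P ∈ S} := by
  refine (shortening_mono D fun P hP => hT.subset hP).lt_of_ne fun heq => ?_
  have hvT : v ∈ shortening D {P | ↑P ∈ T} := heq ▸ h.mem_shortening_iff.2 ⟨hv, subset_rfl⟩
  exact hT.not_subset (h.mem_shortening_iff.1 hvT).2

theorem exists_hasSupport_of_card_eq_minDist (hS : (S.card : ℕ∞) = minDist D)
    (hne : shortening D {P | ↑P ∈ S} ≠ ⊥) : ∃ v ∈ D, HasSupport v S := by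
  obtain ⟨v, hv, hv0, T, hTS, hT⟩ := exists_hasSupport_subset hne
  have hcard : S.card ≤ T.card := by
    rw [← hT.weight_eq, ← Nat.cast_le (α := ℕ∞), hS]
    exact minDist_le_weight hv hv0
  exact ⟨v, hv, Finset.eq_of_subset_of_card_le hTS hcard ▸ hT⟩

theorem exists_hasSupport_weight_eq_minDist_iff :
    (∃ v ∈ D, (weight v : ℕ∞) = minDist D ∧ HasSupport v S) ↔
      (S.card : ℕ∞) = minDist D ∧ shortening D {P | ↑P ∈ S} ≠ ⊥ ∧
        ∀ S' ⊂ S, shortening D {P | ↑P ∈ S'} < shortening D {P | ↑P ∈ S} := by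
  constructor
  · rintro ⟨v, hv, hw, hvS⟩
    exact ⟨hvS.weight_eq ▸ hw, hvS.shortening_ne_bot hv (ne_zero_of_weight_eq_minDist hw),
      fun _ => hvS.shortening_lt hv⟩
  · rintro ⟨hcard, hne, -⟩
    obtain ⟨v, hv, hvS⟩ := exists_hasSupport_of_card_eq_minDist hcard hne
    exact ⟨v, hv, by rw [hvS.weight_eq, hcard], hvS⟩

end Codes

section Main

variable {E : Subscheme F} {d : ℕ} {B S T : Finset (Point F)} {p : B → Fin 3 → F}

theorem IsCoordinates.h1_union_eq (hp : IsCoordinates p) [Module.Finite F (H1 E d)]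
    (hE : ∀ P, ¬ E.ideal ≤ pointIdeal (p P)) (hS : S ⊆ B) :
    h1 (E.union (Subscheme.ofPoints S)) d = h1 E d +
      Module.finrank F (shortening (dualCode (formValues E.ideal d p)) {P | ↑P ∈ S}) := by
  let e (P : S) : B := ⟨P, hS P.2⟩
  have he : Function.Injective e := fun P Q h => Subtype.ext (congrArg (fun R : B => R.1) h)
  have hrange : {P : B | ↑P ∈ S} = Set.range e := by
    ext P
    exact ⟨fun hP => ⟨⟨P, hP⟩, rfl⟩, by rintro ⟨Q, rfl⟩; exact Q.2⟩
  have hvalues : formValues E.ideal d (p ∘ e) =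
      (formValues E.ideal d p).map (LinearMap.funLeft F F e) := by
    rw [formValues, formValues, ← Submodule.map_comp]
    rfl
  have hpe : IsCoordinates (p ∘ e) := fun P => hp (e P)
  rw [hrange, finrank_shortening_dualCode he, ← hvalues,
    hpe.h1_union_ofPoints fun P => hE (e P)]

theorem IsCoordinates.h1_lt_h1_union_iff (hp : IsCoordinates p) [Module.Finite F (H1 E d)]
    (hE : ∀ P, ¬ E.ideal ≤ pointIdeal (p P)) (hS : S ⊆ B) :
    h1 E d < h1 (E.union (Subscheme.ofPoints S)) d ↔
      shortening (dualCode (formValues E.ideal d p)) {P | ↑P ∈ S} ≠ ⊥ := by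
  rw [hp.h1_union_eq hE hS, lt_add_iff_pos_right, Nat.pos_iff_ne_zero, Ne,
    Submodule.finrank_eq_zero]

theorem IsCoordinates.h1_union_lt_h1_union_iff (hp : IsCoordinates p)
    [Module.Finite F (H1 E d)] (hE : ∀ P, ¬ E.ideal ≤ pointIdeal (p P)) (hS : S ⊆ B)
    (hT : T ⊂ S) :
    h1 (E.union (Subscheme.ofPoints T)) d < h1 (E.union (Subscheme.ofPoints S)) d ↔
      shortening (dualCode (formValues E.ideal d p)) {P | ↑P ∈ T} <
        shortening (dualCode (formValues E.ideal d p)) {P | ↑P ∈ S} := by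
  have hle := shortening_mono (dualCode (formValues E.ideal d p))
    (show {P : B | ↑P ∈ T} ⊆ {P | ↑P ∈ S} from fun P hP => hT.subset hP)
  rw [hp.h1_union_eq hE hS, hp.h1_union_eq hE (hT.subset.trans hS), add_lt_add_iff_left]
  exact ⟨fun h => hle.lt_of_ne fun heq => h.ne (by rw [heq]), Submodule.finrank_lt_finrank_of_lt⟩

end Main

end

end PlaneCode

open PlaneCode

theorem proposition3p1_general {F : Type*} [Field F] (f : CoordRing F) (c d : ℕ)
    (hf : f.IsHomogeneous c)
    (E : Subscheme F) (hE : E.IsZeroDimensional) (hEX : Ideal.span {f} ≤ E.ideal)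
    (B : Finset (Point F))
    (p : B → Fin 3 → F) (hp : IsCoordinates p)
    (hBX : ∀ P : B, MvPolynomial.eval (p P) f = 0)
    (hBE : ∀ P : B, ¬ E.ideal ≤ pointIdeal (p P))
    (z : ℕ∞)
    (hz : z = ⨅ (S : Finset (Point F)) (_ : S ⊆ B)
      (_ : h1 (E.union (Subscheme.ofPoints S)) d > h1 E d),
      (S.card : ℕ∞)) :
    minDist (dualCode (evaluationCode f E d p)) = z ∧
    (∀ v ∈ dualCode (evaluationCode f E d p),
      (weight v : ℕ∞) = z ↔
        ∃ S : Finset (Point F), HasSupport v S ∧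
          (S.card : ℕ∞) = z ∧
          h1 (E.union (Subscheme.ofPoints S)) d > h1 E d ∧
          ∀ S' : Finset (Point F), S' ⊂ S →
            h1 (E.union (Subscheme.ofPoints S)) d >
              h1 (E.union (Subscheme.ofPoints S')) d) ∧
    (∀ S : Finset (Point F), S ⊆ B →
      ((∃ v ∈ dualCode (evaluationCode f E d p),
          (weight v : ℕ∞) = z ∧ HasSupport v S) ↔
        (S.card : ℕ∞) = z ∧
          h1 (E.union (Subscheme.ofPoints S)) d > h1 E d ∧
          ∀ S' : Finset (Point F), S' ⊂ S →
            h1 (E.union (Subscheme.ofPoints S)) d >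
              h1 (E.union (Subscheme.ofPoints S')) d)) := by
  have := hE.finite_H1 d
  rw [evaluationCode_eq_formValues hf hEX (fun P => (hp P).1) hBX]
  set D := dualCode (formValues E.ideal d p)
  have hmin : minDist D = z := by
    rw [minDist_eq_iInf_card, hz]
    exact iInf_congr fun S => iInf_congr fun hS =>
      iInf_congr_Prop (hp.h1_lt_h1_union_iff hBE hS).symm fun _ => rfl
  have hsupport (S : Finset (Point F)) (hS : S ⊆ B) :
      (∃ v ∈ D, (weight v : ℕ∞) = z ∧ HasSupport v S) ↔ (S.card : ℕ∞) = z ∧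
        h1 (E.union (Subscheme.ofPoints S)) d > h1 E d ∧
        ∀ S' : Finset (Point F), S' ⊂ S → h1 (E.union (Subscheme.ofPoints S)) d >
          h1 (E.union (Subscheme.ofPoints S')) d := by
    rw [← hmin, exists_hasSupport_weight_eq_minDist_iff]
    exact and_congr_right fun _ => and_congr (hp.h1_lt_h1_union_iff hBE hS).symm
      (forall₂_congr fun _ hS' => (hp.h1_union_lt_h1_union_iff hBE hS hS').symm)
  refine ⟨hmin, fun v hv => ⟨fun hw => ?_, ?_⟩, hsupport⟩
  · obtain ⟨S, hS⟩ := exists_hasSupport v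
    exact ⟨S, hS, (hsupport S hS.1).1 ⟨v, hv, hw, hS⟩⟩
  · rintro ⟨S, hS, hcard, -⟩
    rw [hS.weight_eq, hcard]

theorem proposition3p1 {F : Type*} [Field F] (f : CoordRing F) (c d : ℕ)
    (hf : IsSmoothCurve f c) (hd : 0 < d) (hdc : d < c)
    (E : Subscheme F) (hE : E.IsZeroDimensional) (hEX : Ideal.span {f} ≤ E.ideal)
    (B : Finset (Point F))
    (p : B → Fin 3 → F) (hp : ∀ P : B, ∃ h : p P ≠ 0, Projectivization.mk F (p P) h = P)
    (hBX : ∀ P : B, MvPolynomial.eval (p P) f = 0)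
    (hBE : ∀ P : B, ¬ E.ideal ≤ pointIdeal (p P))
    (z : ℕ∞)
    (hz : z = ⨅ (S : Finset (Point F)) (_ : S ⊆ B)
      (_ : h1 (E.union (Subscheme.ofPoints S)) d > h1 E d),
      (S.card : ℕ∞)) :
    minDist (dualCode (evaluationCode f E d p)) = z ∧
    (∀ v ∈ dualCode (evaluationCode f E d p),
      (weight v : ℕ∞) = z ↔
        ∃ S : Finset (Point F), HasSupport v S ∧
          (S.card : ℕ∞) = z ∧
          h1 (E.union (Subscheme.ofPoints S)) d > h1 E d ∧
          ∀ S' : Finset (Point F), S' ⊂ S →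
            h1 (E.union (Subscheme.ofPoints S)) d >
              h1 (E.union (Subscheme.ofPoints S')) d) ∧
    (∀ S : Finset (Point F), S ⊆ B →
      ((∃ v ∈ dualCode (evaluationCode f E d p),
          (weight v : ℕ∞) = z ∧ HasSupport v S) ↔
        (S.card : ℕ∞) = z ∧
          h1 (E.union (Subscheme.ofPoints S)) d > h1 E d ∧
          ∀ S' : Finset (Point F), S' ⊂ S →
            h1 (E.union (Subscheme.ofPoints S)) d >
              h1 (E.union (Subscheme.ofPoints S')) d)) :=
  proposition3p1_general f c d hf.1 E hE hEX B p hp hBX hBE z hz
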